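/- **Setting.** A CFG program consists of global variables and functions; an internal function is a control-flow graph whose nodes carry the instructions $\mathtt{skip}$, assignment to a local variable, memory store, conditional branch, function call and return. Expressions are side-effect free: local variables, constants (including addresses of symbols and of the stack block), integer unary and binary operators of C, conditional expressions and memory loads. Values are 32-bit integers $\mathtt{vint}(i)$, 64-bit floats, pointers $\mathtt{vptr}(b,i)$ (block $b$, 32-bit byte offset $i$) and $\mathtt{undef}$. The small-step semantics is that of CompCert over its memory model (blocks of abstract bytes with permissions), with external functions behaving arbitrarily. $\mathrm{Reach}(P)$ is the set of execution states reachable from the initial call to $\mathtt{main}$. A state $\sigma$ inside a function has a current program point (a function and a node of its graph) and an environment $\sigma.E$, a partial map from local variables to values. **Analysis.** An abstract memory domain $D$ provides an order test $\mathtt{le}$, an element $\top$, operators $\mathtt{join}$ and $\mathtt{widen}$, abstract transformers $\mathtt{assign}$, $\mathtt{store}$, $\mathtt{assume}$, $\mathtt{forget}$, and $\mathtt{range}$, which gives for each variable a pair (signed range, unsigned range), each an interval of integers or $\bot$. It is *sound for* $P$ if there is a concretization $\gamma$ from abstract values to sets of pairs (environment, memory) such that $\gamma$ is monotone for $\mathtt{le}$,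 $\gamma(\top)$ contains every pair, $\gamma(a)\cup\gamma(b)\subseteq\gamma(\mathtt{join}\,a\,b)$, each transformer over-approximates the corresponding concrete operation ($\mathtt{forget}$ corresponds to a function call, which may change the memory and the result variable arbitrarily), and every integer or pointer offset held by a variable $x$ in an environment of $\gamma(a)$ belongs to both ranges $\mathtt{range}(a,x)$. For each function, $\mathtt{value\_analysis}_D(P)$ asks an arbitrary, untrusted solver for an abstract value at each node, checks with $\mathtt{le}$ that $\top$ is below the value at the entry node and that the transformer of each edge of the control-flow graph maps the value at its source below the value at its target, replaces all the values by $\top$ if the check fails, and then applies $\mathtt{range}$. The analyzer itself uses the domain $D_0$ made of (i) the reduced product of signed and unsigned intervals of machine integers, with forward and backward operators that fall back to $\top$ on a possible overflow, (ii) its non-relational lifting to maps from variables to abstract values, and (iii) a flow-sensitive type information that separates integers from pointers, used to translate C expressions into numerical ones in which a pointer stands for its offset. For a pair $r$ of a signed and an unsigned range, $\mathtt{ints\_in\_range}\;r\;i$ means that the signed interpretation of the 32-bit integer $i$ is in the signed range and its unsigned interpretation is in the unsigned range. **Theorem (Soundness of the value analysis).** Let $P$ be a CFG program, let $D$ be either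 the domain $D_0$ or any domain that is sound for $P$, and let $\mathit{res}=\mathtt{value\_analysis}_D(P)$, computed with any untrusted solver. Let $\sigma\in\mathrm{Reach}(P)$ be a state whose current program point is $l$. Then for every local variable $v\in\mathrm{dom}(\sigma.E)$ and every 32-bit integer $i$ such that $\sigma.E(v)=\mathtt{vint}(i)$ or $\sigma.E(v)=\mathtt{vptr}(b,i)$ for some block $b$, the property $\mathtt{ints\_in\_range}\;\mathit{res}[l,v]\;i$ holds. -/

import Mathlib

namespace CFG

/-! ## Machine integers, floats, finite maps -/

/-- 32-bit machine integers. -/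
abbrev MInt := BitVec 32

/-- 64-bit floating-point numbers, given by their IEEE 754 bit pattern. -/
abbrev F64 := BitVec 64

def minSigned : ℤ := -2 ^ 31
def maxSigned : ℤ := 2 ^ 31 - 1
def maxUnsigned : ℤ := 2 ^ 32 - 1

/-- Unsigned interpretation, in `[0, 2^32 - 1]`. -/
def unsigned (n : MInt) : ℤ := n.toNat

/-- Signed (two's complement) interpretation, in `[-2^31, 2^31 - 1]`. -/
def signed (n : MInt) : ℤ := if unsigned n < 2 ^ 31 then unsigned n else unsigned n - 2 ^ 32

abbrev Ident := ℕ
abbrev Node := ℕ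
abbrev Block := ℕ

/-- Finite partial maps from natural numbers, as association lists.
The first binding of a key is the one that counts. -/
structure PTree (α : Type) where
  bindings : List (ℕ × α)

namespace PTree
variable {α : Type}

def empty : PTree α := ⟨[]⟩
def find (m : PTree α) (k : ℕ) : Option α := m.bindings.lookup k
def keys (m : PTree α) : List ℕ := m.bindings.map Prod.fst
def remove (m : PTree α) (k : ℕ) : PTree α := ⟨m.bindings.filter fun p => p.1 != k⟩
def set (m : PTree α) (k : ℕ) (a : α) : PTree α := ⟨(k, a) :: (m.remove k).bindings⟩

/-- Pointwise combination on the common keys. -/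
def merge (f : α → α → α) (m₁ m₂ : PTree α) : PTree α :=
  ⟨m₁.keys.filterMap fun k =>
    match m₁.find k, m₂.find k with
    | some a, some b => some (k, f a b)
    | _, _ => none⟩

/-- Pointwise order, where an absent key stands for `top`. -/
def le (leElt : α → α → Bool) (top : α) (m₁ m₂ : PTree α) : Bool :=
  m₂.keys.all fun k =>
    match m₂.find k with
    | some b => leElt ((m₁.find k).getD top) b
    | none => true

end PTree

/-! ## Values and memory -/

inductive Val where
  | vint (i : MInt)
  | vfloat (f : F64)
  | vptr (b : Block) (ofs : MInt)
  | undef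
  deriving DecidableEq

inductive Chunk where
  | int8signed | int8unsigned | int16signed | int16unsigned | int32 | float32 | float64
  deriving DecidableEq

/-- Size in bytes. -/
def Chunk.size : Chunk → ℕ
  | int8signed | int8unsigned => 1
  | int16signed | int16unsigned => 2
  | int32 | float32 => 4
  | float64 => 8

/-- Required alignment in bytes. -/
def Chunk.align : Chunk → ℕ
  | int8signed | int8unsigned => 1
  | int16signed | int16unsigned => 2
  | int32 | float32 | float64 => 4

/-- Exact conversion of a single-precision bit pattern to double precision. -/
def widenFloat (x : BitVec 32) : F64 :=
  let s := x.toNat / 2 ^ 31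
  let e := x.toNat / 2 ^ 23 % 2 ^ 8
  let m := x.toNat % 2 ^ 23
  let body :=
    if e = 255 then 2047 * 2 ^ 52 + m * 2 ^ 29
    else if e = 0 then
      if m = 0 then 0
      else (Nat.log2 m + 874) * 2 ^ 52 + (m - 2 ^ Nat.log2 m) * 2 ^ (52 - Nat.log2 m)
    else (e + 896) * 2 ^ 52 + m * 2 ^ 29
  BitVec.ofNat 64 (s * 2 ^ 63 + body)

/-- `q / 2 ^ d`, rounded to nearest, ties to even. -/
def roundShift (q d : ℕ) : ℕ :=
  let t := q / 2 ^ d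
  let r := 2 * (q % 2 ^ d)
  if r > 2 ^ d ∨ (r = 2 ^ d ∧ t % 2 = 1) then t + 1 else t

/-- Rounding of a double-precision bit pattern to single precision
(round to nearest, ties to even; overflow to infinity; NaNs made quiet). -/
def narrowFloat (x : F64) : BitVec 32 :=
  let s := x.toNat / 2 ^ 63
  let e := x.toNat / 2 ^ 52 % 2 ^ 11
  let m := x.toNat % 2 ^ 52
  let body :=
    if e = 2047 then
      if m = 0 then 255 * 2 ^ 23 else 255 * 2 ^ 23 + ((m / 2 ^ 29) ||| 2 ^ 22)
    else
      let q := if e = 0 then m else 2 ^ 52 + m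
      let e' := max (e - 896) 1
      min (255 * 2 ^ 23) ((e' - 1) * 2 ^ 23 + roundShift q (925 + e' - max e 1))
  BitVec.ofNat 32 (s * 2 ^ 31 + body)

/-- Contents of one memory cell: uninitialized, a concrete byte,
or the `n`-th byte of a pointer. -/
inductive Memval where
  | undef
  | byte (b : BitVec 8)
  | ptr (b : Block) (ofs : MInt) (n : ℕ)
  deriving DecidableEq

inductive Perm where
  | nonempty | readable | writable | freeable
  deriving DecidableEq

def Perm.rank : Perm → ℕ
  | nonempty => 0
  | readable => 1
  | writable => 2
  | freeable => 3

/-- Memory states: blocks of abstract bytes with access permissions. -/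
structure Mem where
  contents : Block → ℤ → Memval
  perm : Block → ℤ → Option Perm
  nextblock : Block

namespace Mem

def empty : Mem := ⟨fun _ _ => .undef, fun _ _ => none, 0⟩

def hasPerm (m : Mem) (b : Block) (ofs : ℤ) (p : Perm) : Bool :=
  match m.perm b ofs with
  | some q => decide (p.rank ≤ q.rank)
  | none => false

/-- Permission `p` on `[lo, hi)`. -/
def rangePerm (m : Mem) (b : Block) (lo hi : ℤ) (p : Perm) : Bool :=
  (List.range (hi - lo).toNat).all fun k => m.hasPerm b (lo + k) p

def setPerm (m : Mem) (b : Block) (lo hi : ℤ) (p : Option Perm) : Mem :=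
  { m with perm := fun b' o => if b' = b ∧ lo ≤ o ∧ o < hi then p else m.perm b' o }

def setBytes (m : Mem) (b : Block) (ofs : ℤ) (vl : List Memval) : Mem :=
  { m with contents := fun b' o =>
      if b' = b ∧ ofs ≤ o ∧ o < ofs + vl.length then vl.getD (o - ofs).toNat .undef
      else m.contents b' o }

/-- Allocation of a fresh block with bounds `[lo, hi)`. -/
def alloc (m : Mem) (lo hi : ℤ) : Mem × Block :=
  let b := m.nextblock
  ({ contents := fun b' o => if b' = b then .undef else m.contents b' o
     perm := fun b' o =>
       if b' = b then (if lo ≤ o ∧ o < hi then some .freeable else none) else m.perm b' o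
     nextblock := b + 1 }, b)

def free (m : Mem) (b : Block) (lo hi : ℤ) : Option Mem :=
  if m.rangePerm b lo hi .freeable then some (m.setPerm b lo hi none) else none

def dropPerm (m : Mem) (b : Block) (lo hi : ℤ) (p : Perm) : Option Mem :=
  if m.rangePerm b lo hi .freeable then some (m.setPerm b lo hi (some p)) else none

def validPointer (m : Mem) (b : Block) (ofs : ℤ) : Bool := m.hasPerm b ofs .nonempty

end Mem

/-- The `n` bytes of `x`, in the byte order of the target. -/
def encodeInt (bigEndian : Bool) (n x : ℕ) : List (BitVec 8) :=
  let l := (List.range n).map fun k => BitVec.ofNat 8 (x / 256 ^ k)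
  if bigEndian then l.reverse else l

def decodeInt (bigEndian : Bool) (l : List (BitVec 8)) : ℕ :=
  (if bigEndian then l.reverse else l).foldr (fun b acc => b.toNat + 256 * acc) 0

def injPointer (b : Block) (ofs : MInt) : List Memval :=
  [.ptr b ofs 3, .ptr b ofs 2, .ptr b ofs 1, .ptr b ofs 0]

def zeroExt (k : ℕ) (n : MInt) : MInt := (n.setWidth k).setWidth 32
def signExt (k : ℕ) (n : MInt) : MInt := (n.setWidth k).signExtend 32

def encodeVal (be : Bool) : Chunk → Val → List Memval
  | .int8signed, .vint n | .int8unsigned, .vint n => (encodeInt be 1 n.toNat).map .byte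
  | .int16signed, .vint n | .int16unsigned, .vint n => (encodeInt be 2 n.toNat).map .byte
  | .int32, .vint n => (encodeInt be 4 n.toNat).map .byte
  | .int32, .vptr b ofs => injPointer b ofs
  | .float32, .vfloat f => (encodeInt be 4 (narrowFloat f).toNat).map .byte
  | .float64, .vfloat f => (encodeInt be 8 f.toNat).map .byte
  | κ, _ => List.replicate κ.size .undef

def projBytes (vl : List Memval) : Option (List (BitVec 8)) :=
  vl.mapM fun
    | .byte b => some b
    | _ => none

def projPointer : List Memval → Val
  | .ptr b ofs n :: vl => if .ptr b ofs n :: vl = injPointer b ofs then .vptr b ofs else .undef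
  | _ => .undef

def decodeVal (be : Bool) (κ : Chunk) (vl : List Memval) : Val :=
  match projBytes vl with
  | some bl =>
    let x := decodeInt be bl
    match κ with
    | .int8signed => .vint (signExt 8 (BitVec.ofNat 32 x))
    | .int8unsigned => .vint (zeroExt 8 (BitVec.ofNat 32 x))
    | .int16signed => .vint (signExt 16 (BitVec.ofNat 32 x))
    | .int16unsigned => .vint (zeroExt 16 (BitVec.ofNat 32 x))
    | .int32 => .vint (BitVec.ofNat 32 x)
    | .float32 => .vfloat (widenFloat (BitVec.ofNat 32 x))
    | .float64 => .vfloat (BitVec.ofNat 64 x)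
  | none =>
    match κ with
    | .int32 => projPointer vl
    | _ => .undef

namespace Mem

/-- Accesses at chunk `κ` with permission `p` are allowed at this address. -/
def validAccess (m : Mem) (κ : Chunk) (b : Block) (ofs : ℤ) (p : Perm) : Bool :=
  m.rangePerm b ofs (ofs + κ.size) p && decide ((κ.align : ℤ) ∣ ofs)

def load (be : Bool) (κ : Chunk) (m : Mem) (b : Block) (ofs : ℤ) : Option Val :=
  if m.validAccess κ b ofs .readable then
    some (decodeVal be κ ((List.range κ.size).map fun k => m.contents b (ofs + k)))
  else none

def store (be : Bool) (κ : Chunk) (m : Mem) (b : Block) (ofs : ℤ) (v : Val) : Option Mem :=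
  if m.validAccess κ b ofs .writable then some (m.setBytes b ofs (encodeVal be κ v)) else none

def loadv (be : Bool) (κ : Chunk) (m : Mem) : Val → Option Val
  | .vptr b ofs => m.load be κ b (unsigned ofs)
  | _ => none

def storev (be : Bool) (κ : Chunk) (m : Mem) (addr v : Val) : Option Mem :=
  match addr with
  | .vptr b ofs => m.store be κ b (unsigned ofs) v
  | _ => none

end Mem

/-! ## Syntax of CFG -/

inductive Const where
  | int (n : MInt)
  | float (f : F64)
  | addrsymbol (id : Ident) (n : MInt)
  | addrstack (n : MInt)
  deriving DecidableEq

inductive UnOp where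
  | cast8unsigned | cast8signed | cast16unsigned | cast16signed
  | boolval | negint | notbool | notint
  deriving DecidableEq

inductive Comparison where
  | lt | le | gt | ge | eq | ne
  deriving DecidableEq

/-- `div`, `mod`, `shr` and `cmp` are signed; `divu`, `modu`, `shru` and `cmpu` unsigned. -/
inductive BinOp where
  | add | sub | mul | div | mod
  | shl | shr | and | or | xor
  | divu | modu | shru
  | cmp (c : Comparison)
  | cmpu (c : Comparison)
  deriving DecidableEq

inductive Expr where
  | var (id : Ident)
  | const (c : Const)
  | unop (op : UnOp) (a : Expr)
  | binop (op : BinOp) (a₁ a₂ : Expr)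
  | cond (a₁ a₂ a₃ : Expr)
  | load (κ : Chunk) (a : Expr)

inductive Typ where
  | int | float
  deriving DecidableEq

structure Signature where
  args : List Typ
  res : Option Typ
  deriving DecidableEq

inductive Instr where
  | skip (l : Node)
  | assign (id : Ident) (a : Expr) (l : Node)
  | store (κ : Chunk) (addr a : Expr) (l : Node)
  | ifThenElse (e : Expr) (ltrue lfalse : Node)
  | call (sig : Signature) (res : Option Ident) (a : Expr) (args : List Expr) (l : Node)
  | ret (a : Option Expr)

/-- An internal function: its code is a control-flow graph. -/
structure Func where
  sig : Signature
  params : List Ident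
  vars : List Ident
  stackspace : ℤ
  code : PTree Instr
  entry : Node

structure ExtFun where
  name : Ident
  sig : Signature

inductive FunDef where
  | internal (f : Func)
  | external (ef : ExtFun)

def FunDef.sig : FunDef → Signature
  | internal f => f.sig
  | external ef => ef.sig

/-- Initialization data of global variables. -/
inductive InitData where
  | int8 (n : MInt)
  | int16 (n : MInt)
  | int32 (n : MInt)
  | float32 (f : F64)
  | float64 (f : F64)
  | space (n : ℕ)
  | addrof (id : Ident) (ofs : MInt)

def InitData.size : InitData → ℕ
  | int8 _ => 1
  | int16 _ => 2
  | int32 _ | float32 _ | addrof _ _ => 4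
  | float64 _ => 8
  | space n => n

structure GlobVar where
  data : List InitData
  readonly : Bool
  isVolatile : Bool

inductive GlobDef where
  | func (fd : FunDef)
  | gvar (v : GlobVar)

structure Program where
  defs : List (Ident × GlobDef)
  main : Ident

/-! ## Global environment and initial memory

The `k`-th global definition of a program lives in block `k`. -/

namespace Program

/-- Block of a global symbol (the last definition of a name is the one that counts). -/
def findSymbol (P : Program) (id : Ident) : Option Block :=
  (List.range P.defs.length).reverse.find? fun b => (P.defs[b]?.map Prod.fst) == some id

/-- The function that lives in block `b`, if any. -/
def funAt (P : Program) (b : Block) : Option FunDef :=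
  match P.defs[b]? with
  | some (_, .func fd) => some fd
  | _ => none

/-- The internal function that lives in block `b`, if any. -/
def internalAt (P : Program) (b : Block) : Option Func :=
  match P.funAt b with
  | some (.internal f) => some f
  | _ => none

def storeInit (P : Program) (be : Bool) (b : Block) (m : Mem) (ofs : ℤ) :
    InitData → Option Mem
  | .int8 n => m.store be .int8unsigned b ofs (.vint n)
  | .int16 n => m.store be .int16unsigned b ofs (.vint n)
  | .int32 n => m.store be .int32 b ofs (.vint n)
  | .float32 f => m.store be .float32 b ofs (.vfloat f)
  | .float64 f => m.store be .float64 b ofs (.vfloat f)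
  | .space _ => some m
  | .addrof id o =>
    match P.findSymbol id with
    | some b' => m.store be .int32 b ofs (.vptr b' o)
    | none => none

def storeInitList (P : Program) (be : Bool) (b : Block) : Mem → ℤ → List InitData → Option Mem
  | m, _, [] => some m
  | m, ofs, d :: ds =>
    match P.storeInit be b m ofs d with
    | some m' => P.storeInitList be b m' (ofs + d.size) ds
    | none => none

def allocGlobal (P : Program) (be : Bool) (m : Mem) : GlobDef → Option Mem
  | .func _ =>
    let (m₁, b) := m.alloc 0 1
    m₁.dropPerm b 0 1 .nonempty
  | .gvar v =>
    let sz : ℕ := (v.data.map InitData.size).sum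
    let (m₁, b) := m.alloc 0 sz
    match P.storeInitList be b (m₁.setBytes b 0 (List.replicate sz (.byte 0))) 0 v.data with
    | some m₂ =>
      m₂.dropPerm b 0 sz
        (if v.isVolatile then .nonempty else if v.readonly then .readable else .writable)
    | none => none

/-- The initial memory state, with all the globals allocated and initialized. -/
def initMem (P : Program) (be : Bool) : Option Mem :=
  P.defs.foldlM (fun m d => P.allocGlobal be m d.2) Mem.empty

end Program

/-! ## Operators on values -/

def vtrue : Val := .vint 1
def vfalse : Val := .vint 0
def ofBool (b : Bool) : Val := if b then vtrue else vfalse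

def ofOptBool : Option Bool → Val
  | some b => ofBool b
  | none => .undef

/-- Truth value of an integer or a pointer. -/
def boolOfVal : Val → Option Bool
  | .vint n => some (n != 0)
  | .vptr _ _ => some true
  | _ => none

def evalUnop : UnOp → Val → Val
  | .cast8unsigned, .vint n => .vint (zeroExt 8 n)
  | .cast8signed, .vint n => .vint (signExt 8 n)
  | .cast16unsigned, .vint n => .vint (zeroExt 16 n)
  | .cast16signed, .vint n => .vint (signExt 16 n)
  | .boolval, v => ofOptBool (boolOfVal v)
  | .notbool, v => ofOptBool ((boolOfVal v).map not)
  | .negint, .vint n => .vint (-n)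
  | .notint, .vint n => .vint (~~~n)
  | _, _ => .undef

def Comparison.test (c : Comparison) (x y : ℤ) : Bool :=
  match c with
  | .lt => decide (x < y)
  | .le => decide (x ≤ y)
  | .gt => decide (x > y)
  | .ge => decide (x ≥ y)
  | .eq => decide (x = y)
  | .ne => decide (x ≠ y)

/-- Comparison of pointers to different blocks, or of a pointer with the null integer. -/
def cmpDifferentBlocks : Comparison → Option Bool
  | .eq => some false
  | .ne => some true
  | _ => none

def cmpBool (c : Comparison) : Val → Val → Option Bool
  | .vint n₁, .vint n₂ => some (c.test (signed n₁) (signed n₂))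
  | _, _ => none

def cmpuBool (m : Mem) (c : Comparison) : Val → Val → Option Bool
  | .vint n₁, .vint n₂ => some (c.test (unsigned n₁) (unsigned n₂))
  | .vint n₁, .vptr _ _ => if n₁ = 0 then cmpDifferentBlocks c else none
  | .vptr _ _, .vint n₂ => if n₂ = 0 then cmpDifferentBlocks c else none
  | .vptr b₁ o₁, .vptr b₂ o₂ =>
    if m.validPointer b₁ (unsigned o₁) && m.validPointer b₂ (unsigned o₂) then
      if b₁ = b₂ then some (c.test (unsigned o₁) (unsigned o₂)) else cmpDifferentBlocks c
    else none
  | _, _ => none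

/-- Signed division (truncated) is undefined for a zero divisor and on overflow. -/
def signedDivError (n₁ n₂ : MInt) : Bool :=
  n₂ == 0 || (signed n₁ == minSigned && signed n₂ == -1)

/-- Semantics of binary operators; `none` means that the execution gets stuck. -/
def evalBinop (m : Mem) : BinOp → Val → Val → Option Val
  | .add, .vint n₁, .vint n₂ => some (.vint (n₁ + n₂))
  | .add, .vptr b o, .vint n => some (.vptr b (o + n))
  | .add, .vint n, .vptr b o => some (.vptr b (o + n))
  | .sub, .vint n₁, .vint n₂ => some (.vint (n₁ - n₂))
  | .sub, .vptr b o, .vint n => some (.vptr b (o - n))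
  | .sub, .vptr b₁ o₁, .vptr b₂ o₂ => some (if b₁ = b₂ then .vint (o₁ - o₂) else .undef)
  | .mul, .vint n₁, .vint n₂ => some (.vint (n₁ * n₂))
  | .div, .vint n₁, .vint n₂ =>
    if signedDivError n₁ n₂ then none
    else some (.vint (BitVec.ofInt 32 ((signed n₁).tdiv (signed n₂))))
  | .mod, .vint n₁, .vint n₂ =>
    if signedDivError n₁ n₂ then none
    else some (.vint (BitVec.ofInt 32 ((signed n₁).tmod (signed n₂))))
  | .divu, .vint n₁, .vint n₂ =>
    if n₂ = 0 then none else some (.vint (BitVec.ofNat 32 (n₁.toNat / n₂.toNat)))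
  | .modu, .vint n₁, .vint n₂ =>
    if n₂ = 0 then none else some (.vint (BitVec.ofNat 32 (n₁.toNat % n₂.toNat)))
  | .div, _, _ | .mod, _, _ | .divu, _, _ | .modu, _, _ => none
  | .shl, .vint n₁, .vint n₂ =>
    some (if n₂.toNat < 32 then .vint (n₁ <<< n₂.toNat) else .undef)
  | .shr, .vint n₁, .vint n₂ =>
    some (if n₂.toNat < 32 then .vint (n₁.sshiftRight n₂.toNat) else .undef)
  | .shru, .vint n₁, .vint n₂ =>
    some (if n₂.toNat < 32 then .vint (n₁ >>> n₂.toNat) else .undef)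
  | .and, .vint n₁, .vint n₂ => some (.vint (n₁ &&& n₂))
  | .or, .vint n₁, .vint n₂ => some (.vint (n₁ ||| n₂))
  | .xor, .vint n₁, .vint n₂ => some (.vint (n₁ ^^^ n₂))
  | .cmp c, v₁, v₂ => some (ofOptBool (cmpBool c v₁ v₂))
  | .cmpu c, v₁, v₂ => some (ofOptBool (cmpuBool m c v₁ v₂))
  | _, _, _ => some .undef

/-! ## Small-step semantics -/

/-- Environments map the local variables to their values. -/
abbrev Env := Ident → Option Val

namespace Env

def set (E : Env) (x : Ident) (v : Val) : Env := Function.update E x (some v)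

def setOpt (E : Env) (x : Option Ident) (v : Val) : Env :=
  match x with
  | some x => E.set x v
  | none => E

/-- Parameters bound to the arguments; missing arguments are undefined. -/
def ofParams : List Ident → List Val → Env
  | [], _ => fun _ => none
  | x :: xs, v :: vs => (ofParams xs vs).set x v
  | x :: xs, [] => (ofParams xs []).set x .undef

def setLocals (E : Env) : List Ident → Env
  | [] => E
  | x :: xs => (E.setLocals xs).set x .undef

/-- Variable `x` holds the integer `i` or a pointer with offset `i`. -/
def Holds (E : Env) (x : Ident) (i : MInt) : Prop :=
  E x = some (.vint i) ∨ ∃ b, E x = some (.vptr b i)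

end Env

/-- A program together with what the language leaves to its surroundings: the byte order
of the target and the behaviour of the external functions
(function, arguments, memory before, result, memory after), which is arbitrary. -/
structure Ctx where
  prog : Program
  bigEndian : Bool
  extCall : ExtFun → List Val → Mem → Val → Mem → Prop

def evalConst (P : Program) (sp : Block) : Const → Val
  | .int n => .vint n
  | .float f => .vfloat f
  | .addrsymbol id n =>
    match P.findSymbol id with
    | some b => .vptr b n
    | none => .undef
  | .addrstack n => .vptr sp n

/-- `EvalExpr C sp E m a v`: expression `a` evaluates to `v`, where `sp` is the stack block
of the current function. -/
inductive EvalExpr (C : Ctx) (sp : Block) (E : Env) (m : Mem) : Expr → Val → Prop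
  | var {x v} : E x = some v → EvalExpr C sp E m (.var x) v
  | const {c} : EvalExpr C sp E m (.const c) (evalConst C.prog sp c)
  | unop {op a v} : EvalExpr C sp E m a v → EvalExpr C sp E m (.unop op a) (evalUnop op v)
  | binop {op a₁ a₂ v₁ v₂ v} : EvalExpr C sp E m a₁ v₁ → EvalExpr C sp E m a₂ v₂ →
      evalBinop m op v₁ v₂ = some v → EvalExpr C sp E m (.binop op a₁ a₂) v
  | cond {a₁ a₂ a₃ v₁ b v} : EvalExpr C sp E m a₁ v₁ → boolOfVal v₁ = some b →
      EvalExpr C sp E m (if b then a₂ else a₃) v → EvalExpr C sp E m (.cond a₁ a₂ a₃) v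
  | load {κ a va v} : EvalExpr C sp E m a va → m.loadv C.bigEndian κ va = some v →
      EvalExpr C sp E m (.load κ a) v

/-- A suspended caller: where the result goes, the function (by its block), its stack block,
the node at which it resumes, and its environment. -/
structure Frame where
  res : Option Ident
  fn : Block
  sp : Block
  pc : Node
  env : Env

/-- A program point: a function, designated by its block, and a node of its graph. -/
structure ProgPoint where
  fn : Block
  node : Node

inductive State where
  | regular (stk : List Frame) (fn sp : Block) (pc : Node) (E : Env) (m : Mem)
  | call (stk : List Frame) (fn : Block) (args : List Val) (m : Mem)
  | ret (stk : List Frame) (v : Val) (m : Mem)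

/-- The current program point. Call and return states are in between two points. -/
def State.point : State → Option ProgPoint
  | regular _ fn _ pc _ _ => some ⟨fn, pc⟩
  | _ => none

/-- The environment of the function being executed. -/
def State.env : State → Env
  | regular _ _ _ _ E _ => E
  | _ => fun _ => none

/-- The instruction at a program point. -/
def Program.instrAt (P : Program) (fn : Block) (pc : Node) : Option Instr :=
  (P.internalAt fn).bind fun f => f.code.find pc

inductive Step (C : Ctx) : State → State → Prop
  | skip {stk fn sp pc E m l} :
      C.prog.instrAt fn pc = some (.skip l) →
      Step C (.regular stk fn sp pc E m) (.regular stk fn sp l E m)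
  | assign {stk fn sp pc E m x a l v} :
      C.prog.instrAt fn pc = some (.assign x a l) → EvalExpr C sp E m a v →
      Step C (.regular stk fn sp pc E m) (.regular stk fn sp l (E.set x v) m)
  | store {stk fn sp pc E m κ a₁ a₂ l v₁ v₂ m'} :
      C.prog.instrAt fn pc = some (.store κ a₁ a₂ l) →
      EvalExpr C sp E m a₁ v₁ → EvalExpr C sp E m a₂ v₂ →
      m.storev C.bigEndian κ v₁ v₂ = some m' →
      Step C (.regular stk fn sp pc E m) (.regular stk fn sp l E m')
  | ifThenElse {stk fn sp pc E m e l₁ l₂ v b} :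
      C.prog.instrAt fn pc = some (.ifThenElse e l₁ l₂) →
      EvalExpr C sp E m e v → boolOfVal v = some b →
      Step C (.regular stk fn sp pc E m) (.regular stk fn sp (if b then l₁ else l₂) E m)
  | call {stk fn sp pc E m sig x a args l callee fd vargs} :
      C.prog.instrAt fn pc = some (.call sig x a args l) →
      EvalExpr C sp E m a (.vptr callee 0) → List.Forall₂ (EvalExpr C sp E m) args vargs →
      C.prog.funAt callee = some fd → fd.sig = sig →
      Step C (.regular stk fn sp pc E m) (.call (⟨x, fn, sp, l, E⟩ :: stk) callee vargs m)
  | retNone {stk fn sp pc E m f m'} :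
      C.prog.instrAt fn pc = some (.ret none) → C.prog.internalAt fn = some f →
      m.free sp 0 f.stackspace = some m' →
      Step C (.regular stk fn sp pc E m) (.ret stk .undef m')
  | retSome {stk fn sp pc E m a v f m'} :
      C.prog.instrAt fn pc = some (.ret (some a)) → C.prog.internalAt fn = some f →
      EvalExpr C sp E m a v → m.free sp 0 f.stackspace = some m' →
      Step C (.regular stk fn sp pc E m) (.ret stk v m')
  | enter {stk fn args m f m' sp} :
      C.prog.internalAt fn = some f → m.alloc 0 f.stackspace = (m', sp) →
      Step C (.call stk fn args m)
        (.regular stk fn sp f.entry ((Env.ofParams f.params args).setLocals f.vars) m')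
  | external {stk fn args m ef v m'} :
      C.prog.funAt fn = some (.external ef) → C.extCall ef args m v m' →
      Step C (.call stk fn args m) (.ret stk v m')
  | resume {x fn sp pc E stk v m} :
      Step C (.ret (⟨x, fn, sp, pc, E⟩ :: stk) v m) (.regular stk fn sp pc (E.setOpt x v) m)

/-- Initial states call `main`, without arguments, in the initial memory. -/
inductive Initial (C : Ctx) : State → Prop
  | intro {b fd m} :
      C.prog.initMem C.bigEndian = some m → C.prog.findSymbol C.prog.main = some b →
      C.prog.funAt b = some fd → fd.sig = ⟨[], some .int⟩ →
      Initial C (.call [] b [] m)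

/-- The states that occur in the executions of the program. -/
def Reach (C : Ctx) : Set State :=
  {σ | ∃ σ₀, Initial C σ₀ ∧ Relation.ReflTransGen (Step C) σ₀ σ}

/-! ## Intervals -/

inductive SignFlag where
  | signed | unsigned
  deriving DecidableEq

/-- `A` with an extra bottom element `none`. -/
abbrev BotLift (A : Type) := Option A

/-- Intervals of integers; empty when `max < min`. -/
structure Itv where
  min : ℤ
  max : ℤ
  deriving DecidableEq

/-- The interpretation of a machine integer selected by the flag. -/
def SignFlag.val : SignFlag → MInt → ℤ
  | .signed => CFG.signed
  | .unsigned => CFG.unsigned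

/-- Concretization of (lifted) intervals; that of bottom is empty. -/
def Itv.gamma (s : SignFlag) : BotLift Itv → Set MInt
  | none => ∅
  | some i => {n | i.min ≤ s.val n ∧ s.val n ≤ i.max}

/-- `i` is in both the signed and the unsigned range. -/
def IntsInRange (r : SignFlag → BotLift Itv) (i : MInt) : Prop :=
  i ∈ Itv.gamma .signed (r .signed) ∩ Itv.gamma .unsigned (r .unsigned)

/-! ## Abstract domains: operations -/

structure ADom (A : Type) where
  le : A → A → Bool
  top : A
  join : A → A → A
  widen : A → A → A

namespace ADom
variable {A B : Type}

def liftBot (D : ADom A) : ADom (BotLift A) where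
  le
    | none, _ => true
    | some _, none => false
    | some a, some b => D.le a b
  top := some D.top
  join
    | none, y => y
    | x, none => x
    | some a, some b => some (D.join a b)
  widen
    | none, y => y
    | x, none => x
    | some a, some b => some (D.widen a b)

def prod (D : ADom A) (D' : ADom B) : ADom (A × B) where
  le x y := D.le x.1 y.1 && D'.le x.2 y.2
  top := (D.top, D'.top)
  join x y := (D.join x.1 y.1, D'.join x.2 y.2)
  widen x y := (D.widen x.1 y.1, D'.widen x.2 y.2)

/-- Finite maps, in which an absent key stands for `top`. -/
def tree (D : ADom A) : ADom (PTree A) where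
  le := PTree.le D.le D.top
  top := PTree.empty
  join := PTree.merge D.join
  widen := PTree.merge D.widen

/-- The laws of an abstract domain with concretization `γ`. -/
structure Sound (D : ADom A) (γ : A → Set B) : Prop where
  gamma_monotone : ∀ a₁ a₂, D.le a₁ a₂ = true → γ a₁ ⊆ γ a₂
  top_sound : ∀ x, x ∈ γ D.top
  join_sound : ∀ a₁ a₂, γ a₁ ∪ γ a₂ ⊆ γ (D.join a₁ a₂)

end ADom

/-- Abstraction of numerical values. In `backwardUnop op x z` and `backwardBinop op x y z`,
`x` and `y` abstract the operands and `z` the result; the output refines the operands. -/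
structure NumDom (t : Type) extends ADom t where
  meet : t → t → BotLift t
  range : t → SignFlag → BotLift Itv
  const : MInt → t
  forwardUnop : UnOp → t → BotLift t
  forwardBinop : BinOp → t → t → BotLift t
  backwardUnop : UnOp → t → t → BotLift t
  backwardBinop : BinOp → t → t → t → BotLift t × BotLift t

/-- Numerical expressions. -/
inductive NExpr where
  | var (x : Ident)
  | const (n : MInt)
  | unop (op : UnOp) (e : NExpr)
  | binop (op : BinOp) (e₁ e₂ : NExpr)
  | cond (e₁ e₂ e₃ : NExpr)

/-- Abstraction of numerical environments. -/
structure IntDom (t : Type) extends ADom t where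
  range : NExpr → t → SignFlag → BotLift Itv
  forget : Ident → t → t
  assign : Ident → NExpr → t → t
  assume : NExpr → t → t

/-- Abstraction of local environments and memory. `forget` is the effect of a function call:
what was known about the memory and about the variable that receives the result,
if there is one, is forgotten. -/
structure MemDom (t : Type) extends ADom t where
  range : t → Ident → SignFlag → BotLift Itv
  forget : Option Ident → t → t
  assign : Ident → Expr → t → t
  store : Chunk → Expr → Expr → t → t
  assume : Expr → t → t

/-! ## Fixpoint checking and the value analysis -/

section Analysis
variable {t : Type}

/-- The validator of candidate post-fixpoints. -/
def checkFxp (D : ADom t) (code : PTree Instr) (entry : Node)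
    (transfer : Node → Instr → List (Node × (t → t))) (init : t) (fxp : Node → t) : Bool :=
  D.le init (fxp entry) &&
    code.keys.all fun pc =>
      match code.find pc with
      | some i => (transfer pc i).all fun p => D.le (p.2 (fxp pc)) (fxp p.1)
      | none => true

/-- The candidate proposed by the untrusted solver if it passes the check, `top` otherwise. -/
def solvePfp (D : ADom t) (externFixpoint : Node → PTree Instr → Node → t)
    (code : PTree Instr) (entry : Node)
    (transfer : Node → Instr → List (Node × (t → t))) (init : t) : Node → t :=
  let fxp := externFixpoint entry code
  if checkFxp D code entry transfer init fxp then fxp else fun _ => D.top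

def MemDom.transfer (D : MemDom t) (_ : Node) : Instr → List (Node × (t → t))
  | .skip l => [(l, id)]
  | .assign x a l => [(l, D.assign x a)]
  | .store κ a₁ a₂ l => [(l, D.store κ a₁ a₂)]
  | .ifThenElse e l₁ l₂ => [(l₁, D.assume e), (l₂, D.assume (.unop .notbool e))]
  | .call _ x _ _ l => [(l, D.forget x)]
  | .ret _ => []

/-- The value analysis of program `P` over the domain `D`, run with an untrusted solver:
for each program point and each variable, a pair of ranges. -/
def valueAnalysis (D : MemDom t) (externFixpoint : Node → PTree Instr → Node → t)
    (P : Program) (l : ProgPoint) : Ident → SignFlag → BotLift Itv :=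
  match P.internalAt l.fn with
  | some f => D.range (solvePfp D.toADom externFixpoint f.code f.entry D.transfer D.top l.node)
  | none => D.range D.top

end Analysis

/-! ## Laws of memory domains -/

section Laws
variable (C : Ctx)

def Assign (x : Ident) (a : Expr) (Q : Set (Env × Mem)) : Set (Env × Mem) :=
  {s | ∃ sp E v, (E, s.2) ∈ Q ∧ EvalExpr C sp E s.2 a v ∧ s.1 = E.set x v}

def Store (κ : Chunk) (a₁ a₂ : Expr) (Q : Set (Env × Mem)) : Set (Env × Mem) :=
  {s | ∃ sp m v₁ v₂, (s.1, m) ∈ Q ∧ EvalExpr C sp s.1 m a₁ v₁ ∧ EvalExpr C sp s.1 m a₂ v₂ ∧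
    m.storev C.bigEndian κ v₁ v₂ = some s.2}

def Assume (a : Expr) (Q : Set (Env × Mem)) : Set (Env × Mem) :=
  {s | s ∈ Q ∧ ∃ sp v, EvalExpr C sp s.1 s.2 a v ∧ boolOfVal v = some true}

def Forget (x : Option Ident) (Q : Set (Env × Mem)) : Set (Env × Mem) :=
  {s | ∃ E m v, (E, m) ∈ Q ∧ s.1 = E.setOpt x v}

/-- The laws of a memory domain with concretization `γ`. -/
structure MemDom.Sound {t : Type} (D : MemDom t) (γ : t → Set (Env × Mem)) : Prop
    extends D.toADom.Sound γ where
  range_sound : ∀ ab E m x i, (E, m) ∈ γ ab → E.Holds x i → IntsInRange (D.range ab x) i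
  forget_sound : ∀ x ab, Forget x (γ ab) ⊆ γ (D.forget x ab)
  assign_sound : ∀ x a ab, Assign C x a (γ ab) ⊆ γ (D.assign x a ab)
  store_sound : ∀ κ a₁ a₂ ab, Store C κ a₁ a₂ (γ ab) ⊆ γ (D.store κ a₁ a₂ ab)
  assume_sound : ∀ a ab, Assume C a (γ ab) ⊆ γ (D.assume a ab)

end Laws

/-! ## Abstraction of numerical values by intervals -/

namespace Itv

/-- The interval of all machine integers under the interpretation `s`. -/
def top : SignFlag → Itv
  | .signed => ⟨minSigned, maxSigned⟩
  | .unsigned => ⟨0, maxUnsigned⟩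

def le (i j : Itv) : Bool := decide (j.min ≤ i.min ∧ i.max ≤ j.max)

/-- The canonical representation of an interval that may be empty. -/
def reduce (a b : ℤ) : BotLift Itv := if a ≤ b then some ⟨a, b⟩ else none

def meet (i j : Itv) : BotLift Itv := reduce (Max.max i.min j.min) (Min.min i.max j.max)

def join (i j : Itv) : Itv := ⟨Min.min i.min j.min, Max.max i.max j.max⟩

def widen (s : SignFlag) (i j : Itv) : Itv :=
  ⟨if j.min < i.min then (top s).min else i.min, if i.max < j.max then (top s).max else i.max⟩

def adom (s : SignFlag) : ADom Itv := ⟨le, top s, join, widen s⟩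

/-- Falls back to `top` when the bounds may overflow. -/
def repr (s : SignFlag) (i : Itv) : Itv := if le i (top s) then i else top s

def singleton (k : ℤ) : Itv := ⟨k, k⟩

/-- The interval for the interpretation `q` of integers in `i` under the interpretation `s`. -/
def convert (s q : SignFlag) (i : Itv) : Itv :=
  match s, q with
  | .signed, .unsigned =>
    if 0 ≤ i.min then i else if i.max < 0 then ⟨i.min + 2 ^ 32, i.max + 2 ^ 32⟩
    else top .unsigned
  | .unsigned, .signed =>
    if i.max ≤ maxSigned then i
    else if maxSigned < i.min then ⟨i.min - 2 ^ 32, i.max - 2 ^ 32⟩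
    else top .signed
  | _, _ => i

/-- Both interpretations `s` and `q` agree on the elements of `i` (read with `s`). -/
def agree (s q : SignFlag) (i : Itv) : Bool :=
  match s, q with
  | .signed, .unsigned => decide (0 ≤ i.min)
  | .unsigned, .signed => decide (i.max ≤ maxSigned)
  | _, _ => true

/-- `0` is not in the interval. -/
def nonzero (i : Itv) : Bool := decide (0 < i.min ∨ i.max < 0)

/-- `0` is the only possible element of the interval. -/
def isZero (i : Itv) : Bool := decide (i.min = 0 ∧ i.max = 0)

def boolval (i : Itv) : Itv :=
  if i.nonzero then singleton 1 else if i.isZero then singleton 0 else ⟨0, 1⟩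

def notbool (i : Itv) : Itv :=
  if i.nonzero then singleton 0 else if i.isZero then singleton 1 else ⟨0, 1⟩

/-- Zero extension of the `k` low-order bits. -/
def castUnsigned (k : ℕ) (i : Itv) : Itv :=
  if le i ⟨0, 2 ^ k - 1⟩ then i else ⟨0, 2 ^ k - 1⟩

/-- Sign extension of the `k` low-order bits. -/
def castSigned (s : SignFlag) (k : ℕ) (i : Itv) : Itv :=
  if le i ⟨-2 ^ (k - 1), 2 ^ (k - 1) - 1⟩ then i
  else repr s ⟨-2 ^ (k - 1), 2 ^ (k - 1) - 1⟩

def forwardUnop (s : SignFlag) (op : UnOp) (i : Itv) : Itv :=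
  match op with
  | .cast8unsigned => castUnsigned 8 i
  | .cast8signed => castSigned s 8 i
  | .cast16unsigned => castUnsigned 16 i
  | .cast16signed => castSigned s 16 i
  | .boolval => boolval i
  | .notbool => notbool i
  | .negint => repr s ⟨-i.max, -i.min⟩
  | .notint => repr s ⟨(top s).min + (top s).max - i.max, (top s).min + (top s).max - i.min⟩

def add (s : SignFlag) (i j : Itv) : Itv := repr s ⟨i.min + j.min, i.max + j.max⟩

def sub (s : SignFlag) (i j : Itv) : Itv := repr s ⟨i.min - j.max, i.max - j.min⟩

def mul (s : SignFlag) (i j : Itv) : Itv :=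
  let a := i.min * j.min
  let b := i.min * j.max
  let c := i.max * j.min
  let d := i.max * j.max
  repr s ⟨Min.min (Min.min a b) (Min.min c d), Max.max (Max.max a b) (Max.max c d)⟩

/-- Truncated division under the interpretation `q`; precise for positive divisors. -/
def div (s q : SignFlag) (i j : Itv) : Itv :=
  if agree s q i && agree s q j && decide (0 < j.min) then
    repr s ⟨Min.min (i.min.tdiv j.min) (i.min.tdiv j.max),
      Max.max (i.max.tdiv j.min) (i.max.tdiv j.max)⟩
  else top s

/-- Remainder under the interpretation `q`; precise for positive divisors. -/
def mod (s q : SignFlag) (i j : Itv) : Itv :=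
  if agree s q i && agree s q j && decide (0 < j.min) then
    repr s ⟨if 0 ≤ i.min then 0 else Max.max i.min (1 - j.max),
      if i.max ≤ 0 then 0 else Min.min i.max (j.max - 1)⟩
  else top s

/-- The shift amount, when it is known and legal. -/
def shiftAmount (j : Itv) : Option ℕ :=
  if j.min = j.max ∧ 0 ≤ j.min ∧ j.min < 32 then some j.min.toNat else none

def shl (s : SignFlag) (i j : Itv) : Itv :=
  match shiftAmount j with
  | some k => repr s ⟨i.min * 2 ^ k, i.max * 2 ^ k⟩
  | none => top s

/-- Right shift under the interpretation `q`. -/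
def shr (s q : SignFlag) (i j : Itv) : Itv :=
  match shiftAmount j with
  | some k => if agree s q i then repr s ⟨i.min / 2 ^ k, i.max / 2 ^ k⟩ else top s
  | none => top s

def and (s : SignFlag) (i j : Itv) : Itv :=
  if 0 ≤ i.min ∧ 0 ≤ j.min then repr s ⟨0, Min.min i.max j.max⟩ else top s

/-- Bitwise disjunction, inclusive or exclusive. -/
def or (s : SignFlag) (i j : Itv) : Itv :=
  if 0 ≤ i.min ∧ 0 ≤ j.min then
    repr s ⟨0, 2 ^ Nat.size (Max.max i.max j.max).toNat - 1⟩
  else top s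

/-- The comparison holds for all elements of `i` and `j`. -/
def mustHold (c : Comparison) (i j : Itv) : Bool :=
  match c with
  | .lt => decide (i.max < j.min)
  | .le => decide (i.max ≤ j.min)
  | .gt => decide (j.max < i.min)
  | .ge => decide (j.max ≤ i.min)
  | .eq => decide (i.min = i.max ∧ j.min = j.max ∧ i.min = j.min)
  | .ne => decide (i.max < j.min ∨ j.max < i.min)

end Itv

def Comparison.negate : Comparison → Comparison
  | .lt => .ge
  | .le => .gt
  | .gt => .le
  | .ge => .lt
  | .eq => .ne
  | .ne => .eq

namespace Itv

/-- The comparison `c` under the interpretation `q` amounts to the same comparison under `s`. -/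
def cmpAgree (s q : SignFlag) (c : Comparison) (i j : Itv) : Bool :=
  c == .eq || c == .ne || (agree s q i && agree s q j)

def cmp (s q : SignFlag) (c : Comparison) (i j : Itv) : Itv :=
  if cmpAgree s q c i j then
    if mustHold c i j then singleton 1
    else if mustHold c.negate i j then singleton 0 else ⟨0, 1⟩
  else ⟨0, 1⟩

def forwardBinop (s : SignFlag) (op : BinOp) (i j : Itv) : Itv :=
  match op with
  | .add => add s i j
  | .sub => sub s i j
  | .mul => mul s i j
  | .div => div s .signed i j
  | .mod => mod s .signed i j
  | .divu => div s .unsigned i j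
  | .modu => mod s .unsigned i j
  | .shl => shl s i j
  | .shr => shr s .signed i j
  | .shru => shr s .unsigned i j
  | .and => and s i j
  | .or | .xor => or s i j
  | .cmp c => cmp s .signed c i j
  | .cmpu c => cmp s .unsigned c i j

/-- Removes `k` when it is a bound of the interval. -/
def remove (k : ℤ) (i : Itv) : BotLift Itv :=
  if i.min = k then reduce (k + 1) i.max
  else if i.max = k then reduce i.min (k - 1)
  else some i

/-- Refinement of the operand `i` of a unary operation with result in `z`. -/
def backwardUnop (s : SignFlag) (op : UnOp) (i z : Itv) : BotLift Itv :=
  match op with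
  | .boolval =>
    if z.nonzero then remove 0 i else if z.isZero then meet i (singleton 0) else some i
  | .notbool =>
    if z.nonzero then meet i (singleton 0) else if z.isZero then remove 0 i else some i
  | .negint | .notint => meet i (forwardUnop s op z)
  | _ => some i

def backwardLt (s : SignFlag) (i j : Itv) : BotLift Itv × BotLift Itv :=
  (meet i ⟨(top s).min, j.max - 1⟩, meet j ⟨i.min + 1, (top s).max⟩)

def backwardLe (s : SignFlag) (i j : Itv) : BotLift Itv × BotLift Itv :=
  (meet i ⟨(top s).min, j.max⟩, meet j ⟨i.min, (top s).max⟩)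

/-- Refinement of `i` and `j`, given that the comparison holds. -/
def backwardCmp (s : SignFlag) (c : Comparison) (i j : Itv) : BotLift Itv × BotLift Itv :=
  match c with
  | .lt => backwardLt s i j
  | .le => backwardLe s i j
  | .gt => (backwardLt s j i).swap
  | .ge => (backwardLe s j i).swap
  | .eq => (meet i j, meet i j)
  | .ne => (if j.min = j.max then remove j.min i else some i,
            if i.min = i.max then remove i.min j else some j)

/-- Refinement of `i` and `j`, given the result `z` of the comparison under `q`. -/
def backwardTest (s q : SignFlag) (c : Comparison) (i j z : Itv) : BotLift Itv × BotLift Itv :=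
  let c' := c.negate
  if z.nonzero && cmpAgree s q c i j then backwardCmp s c i j
  else if z.isZero && cmpAgree s q c' i j then backwardCmp s c' i j
  else (some i, some j)

/-- Refinement of the operands `i` and `j` of a binary operation with result in `z`. -/
def backwardBinop (s : SignFlag) (op : BinOp) (i j z : Itv) : BotLift Itv × BotLift Itv :=
  match op with
  | .add => (meet i (sub s z j), meet j (sub s z i))
  | .sub => (meet i (add s z j), meet j (sub s i z))
  | .cmp c => backwardTest s .signed c i j z
  | .cmpu c => backwardTest s .unsigned c i j z
  | _ => (some i, some j)

/-- Intervals of machine integers under the interpretation `s`. -/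
def numDom (s : SignFlag) : NumDom Itv where
  toADom := adom s
  meet := meet
  range i q := some (convert s q i)
  const n := singleton (s.val n)
  forwardUnop op i := some (forwardUnop s op i)
  forwardBinop op i j := some (forwardBinop s op i j)
  backwardUnop := backwardUnop s
  backwardBinop := backwardBinop s

/-- Intersection of lifted intervals. -/
def meetBot : BotLift Itv → BotLift Itv → BotLift Itv
  | some i, some j => meet i j
  | _, _ => none

/-- Exchange of information between a signed and an unsigned interval. -/
def exchange : BotLift Itv → BotLift Itv → BotLift (Itv × Itv)
  | some i, some j =>
    match meet i (convert .unsigned .signed j), meet j (convert .signed .unsigned i) with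
    | some i', some j' => some (i', j')
    | _, _ => none
  | _, _ => none

end Itv

/-- Reduced product of two abstractions of numerical values, with reduction operator `ρ`. -/
def NumDom.reducedProduct {t t' : Type} (N : NumDom t) (N' : NumDom t')
    (ρ : BotLift t → BotLift t' → BotLift (t × t')) : NumDom (t × t') where
  toADom := N.toADom.prod N'.toADom
  meet x y := ρ (N.meet x.1 y.1) (N'.meet x.2 y.2)
  range x q := Itv.meetBot (N.range x.1 q) (N'.range x.2 q)
  const n := (N.const n, N'.const n)
  forwardUnop op x := ρ (N.forwardUnop op x.1) (N'.forwardUnop op x.2)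
  forwardBinop op x y := ρ (N.forwardBinop op x.1 y.1) (N'.forwardBinop op x.2 y.2)
  backwardUnop op x z := ρ (N.backwardUnop op x.1 z.1) (N'.backwardUnop op x.2 z.2)
  backwardBinop op x y z :=
    let p := N.backwardBinop op x.1 y.1 z.1
    let p' := N'.backwardBinop op x.2 y.2 z.2
    (ρ p.1 p'.1, ρ p.2 p'.2)

/-! ## Non-relational numerical environments -/

namespace NonRel
variable {t : Type} (N : NumDom t)

abbrev AEnv (t : Type) := BotLift (PTree t)

def adom : ADom (AEnv t) := N.toADom.tree.liftBot

def get (ab : AEnv t) (x : Ident) : BotLift t :=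
  ab.map fun m => (m.find x).getD N.top

/-- Binding a variable to bottom makes the whole environment bottom. -/
def set (ab : AEnv t) (x : Ident) (a : BotLift t) : AEnv t :=
  match ab, a with
  | some m, some a => some (m.set x a)
  | _, _ => none

/-- Abstract value of an expression. -/
def eval : NExpr → AEnv t → BotLift t
  | .var x, ab => get N ab x
  | .const n, ab => ab.map fun _ => N.const n
  | .unop op e, ab => (eval e ab).bind (N.forwardUnop op)
  | .binop op e₁ e₂, ab =>
    (eval e₁ ab).bind fun a₁ => (eval e₂ ab).bind fun a₂ => N.forwardBinop op a₁ a₂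
  | .cond b l r, ab =>
    (eval b ab).bind fun a =>
      N.toADom.liftBot.join
        ((N.backwardUnop .boolval a (N.const 1)).bind fun _ => eval l ab)
        ((N.meet a (N.const 0)).bind fun _ => eval r ab)

/-- Refines an environment, given that the expression evaluates to an element of `z`. -/
def backwardExpr : NExpr → AEnv t → t → AEnv t
  | .var x, ab, z => set ab x ((get N ab x).bind fun a => N.meet a z)
  | .const n, ab, z => (N.meet (N.const n) z).bind fun _ => ab
  | .unop op e, ab, z =>
    ((eval N e ab).bind fun a => N.backwardUnop op a z).bind fun a' => backwardExpr e ab a'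
  | .binop op e₁ e₂, ab, z =>
    (eval N e₁ ab).bind fun a₁ => (eval N e₂ ab).bind fun a₂ =>
      let p := N.backwardBinop op a₁ a₂ z
      p.1.bind fun a₁' => p.2.bind fun a₂' => backwardExpr e₁ (backwardExpr e₂ ab a₂') a₁'
  | .cond b l r, ab, z =>
    (adom N).join
      (backwardExpr b (backwardExpr r ab z) (N.const 0))
      (((eval N b ab).bind fun a => N.backwardUnop .boolval a (N.const 1)).bind fun a' =>
        backwardExpr b (backwardExpr l ab z) a')

def make : IntDom (AEnv t) where
  toADom := adom N
  range e ab q := (eval N e ab).bind fun a => N.range a q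
  forget x ab := ab.map fun m => m.remove x
  assign x e ab := set ab x (eval N e ab)
  assume e ab := backwardExpr N e ab (N.const 1)

end NonRel

/-! ## Memory domain -/

/-- Type information on values: `int` stands for the values that are not pointers,
`ptr` for those that are not integers. -/
inductive Ty where
  | int | ptr | any
  deriving DecidableEq

namespace Ty

def join (a b : Ty) : Ty := if a = b then a else any

def adom : ADom Ty where
  le a b := decide (b = any ∨ a = b)
  top := any
  join := join
  widen := join

end Ty

abbrev TypeInfo := PTree Ty

namespace AbMem

/-- The type of an expression. -/
def typeOf (tp : TypeInfo) : Expr → Ty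
  | .var x => (tp.find x).getD .any
  | .const (.int _) => .int
  | .const (.float _) => .int
  | .const (.addrsymbol _ _) => .ptr
  | .const (.addrstack _) => .ptr
  | .unop _ _ => .int
  | .binop .add a₁ a₂ =>
    match typeOf tp a₁, typeOf tp a₂ with
    | .int, .int => .int
    | .int, .ptr => .ptr
    | .ptr, .int => .ptr
    | _, _ => .any
  | .binop .sub a₁ a₂ =>
    match typeOf tp a₁, typeOf tp a₂ with
    | .int, _ => .int
    | .ptr, .int => .ptr
    | .ptr, .ptr => .int
    | _, _ => .any
  | .binop _ _ _ => .int
  | .cond _ a₂ a₃ => (typeOf tp a₂).join (typeOf tp a₃)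
  | .load .int32 _ => .any
  | .load _ _ => .int

/-- Translation into a numerical expression, in which a pointer is represented by its offset.
It fails where integers and pointers behave differently and the type information
does not exclude pointers. -/
def convert (tp : TypeInfo) : Expr → Option NExpr
  | .var x => some (.var x)
  | .const (.int n) => some (.const n)
  | .const (.float _) => none
  | .const (.addrsymbol _ n) => some (.const n)
  | .const (.addrstack n) => some (.const n)
  | .unop op a =>
    if (op = .boolval ∨ op = .notbool) ∧ typeOf tp a ≠ .int then none
    else (convert tp a).map (.unop op)
  | .binop op a₁ a₂ =>
    match op with
    | .cmpu c =>
      if typeOf tp a₁ = .int ∧ typeOf tp a₂ = .int then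
        (convert tp a₁).bind fun e₁ => (convert tp a₂).map fun e₂ => .binop (.cmpu c) e₁ e₂
      else none
    | op => (convert tp a₁).bind fun e₁ => (convert tp a₂).map fun e₂ => .binop op e₁ e₂
  | .cond a₁ a₂ a₃ =>
    if typeOf tp a₁ = .int then
      (convert tp a₁).bind fun e₁ => (convert tp a₂).bind fun e₂ =>
        (convert tp a₃).map fun e₃ => .cond e₁ e₂ e₃
    else none
  | .load _ _ => none

variable {t : Type} (num : IntDom t)

def forget (x : Ident) (ab : t × TypeInfo) : t × TypeInfo :=
  (num.forget x ab.1, ab.2.remove x)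

def assign (x : Ident) (a : Expr) (ab : t × TypeInfo) : t × TypeInfo :=
  match convert ab.2 a with
  | none => forget num x ab
  | some e => (num.assign x e ab.1, ab.2.set x (typeOf ab.2 a))

/-- Assumes that the expression evaluates to a true value. -/
def assume (a : Expr) (ab : t × TypeInfo) : t × TypeInfo :=
  match convert ab.2 (.unop .boolval a) with
  | none => ab
  | some e => (num.assume e ab.1, ab.2)

/-- Only the values of local variables are tracked: the contents of memory are not. -/
def make : MemDom (t × TypeInfo) where
  toADom := num.toADom.prod Ty.adom.tree
  range ab x := num.range (.var x) ab.1
  forget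
    | some x, ab => forget num x ab
    | none, ab => ab
  assign := assign num
  store _ _ _ ab := ab
  assume := assume num

end AbMem

/-- Reduced product of signed and unsigned intervals. -/
def rangeDom : NumDom (Itv × Itv) :=
  (Itv.numDom .signed).reducedProduct (Itv.numDom .unsigned) Itv.exchange

/-- The memory domain of the analyzer, built from the layers above. -/
def memDom : MemDom (NonRel.AEnv (Itv × Itv) × TypeInfo) :=
  AbMem.make (NonRel.make rangeDom)

end CFG

/-!
# Soundness of the value analysis

An execution keeps an invariant with respect to the solution that the analysis reads its ranges
from (`StateOk`): the concretization of the solution at the current point contains the current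
environment and memory, and the solution at the resumption point of every suspended caller is ready
for any result and any memory. The solver plays no role: either its answer passes the check, and is
then above `top` at the entry (`solvePfp_entry`) and closed under the transformers of the edges
(`solvePfp_edge`), or it is replaced by `top`. The laws of a sound memory domain are what each step
of the semantics needs to keep the invariant (`StateOk.step`), and its range law gives the
conclusion (`valueAnalysis_sound`).

It remains that the domain of the analyzer is sound (`exists_memDom_sound`). This is proved layer by
layer.

* On intervals, an arithmetic operator bounds an operation on unbounded integers, of which the
  machine operation is the wrapped result; `repr` keeps the bounds only if nothing wraps
  (`Itv.mem_repr`). An operator of one sign is precise on intervals of the other only where the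
  signed and unsigned interpretations coincide (`Itv.val_eq_of_agree`).
* The reduced product and the non-relational environments preserve the laws of the layer below,
  relative to a semantics of numerical expressions in total integer environments (`NExpr.eval`).
* An environment of the program is related to the integer environments that give every integer its
  value and every pointer its offset (`AbMem.EnvRep`). Variables that hold neither may have any
  value there: in this way an expression that evaluates to `undef` still has a numerical value, and
  bottom is never the abstract value of an expression that does evaluate. The type information
  excludes pointers where they would not behave like their offsets (`AbMem.convert_sound`).
-/

namespace CFG

/-! ### Finite maps and generic abstract domains -/

namespace PTree
variable {α : Type}

theorem find_remove (m : PTree α) (k k' : ℕ) :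
    (m.remove k).find k' = if k' = k then none else m.find k' := by
  obtain ⟨l⟩ := m
  simp only [find, remove]
  induction l with
  | nil => simp
  | cons p l ih =>
    obtain ⟨a, b⟩ := p
    simp only [List.filter_cons, List.lookup_cons]
    grind

theorem find_set (m : PTree α) (k k' : ℕ) (a : α) :
    (m.set k a).find k' = if k' = k then some a else m.find k' := by
  have h := find_remove m k k'
  simp only [find, set, List.lookup_cons] at h ⊢
  grind

theorem mem_bindings_of_find {m : PTree α} {k : ℕ} {a : α} (h : m.find k = some a) :
    (k, a) ∈ m.bindings := by
  obtain ⟨l₁, l₂, h, -⟩ := List.lookup_eq_some_iff.1 h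
  simp [h]

theorem mem_keys_of_find {m : PTree α} {k : ℕ} {a : α} (h : m.find k = some a) : k ∈ m.keys :=
  List.mem_map.2 ⟨_, mem_bindings_of_find h, rfl⟩

theorem find_merge_eq_some {f : α → α → α} {m₁ m₂ : PTree α} {k : ℕ} {c : α}
    (h : (merge f m₁ m₂).find k = some c) :
    ∃ a b, m₁.find k = some a ∧ m₂.find k = some b ∧ c = f a b := by
  obtain ⟨k', -, h⟩ := List.mem_filterMap.1 (mem_bindings_of_find h)
  split at h
  · simp only [Option.some.injEq, Prod.mk.injEq] at h
    obtain ⟨rfl, rfl⟩ := h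
    exact ⟨_, _, ‹_›, ‹_›, rfl⟩
  · simp at h

theorem le_find {le : α → α → Bool} {top : α} {m₁ m₂ : PTree α} (h : m₁.le le top m₂ = true)
    {k : ℕ} {b : α} (hb : m₂.find k = some b) : le ((m₁.find k).getD top) b = true := by
  have := List.all_eq_true.1 h k (mem_keys_of_find hb)
  simpa [hb] using this

end PTree

/-- Concretization of a lifted domain: nothing satisfies bottom. -/
def gammaBot {A B : Type} (γ : A → Set B) : BotLift A → Set B
  | none => ∅
  | some a => γ a

theorem mem_gammaBot_bind {A A' B B' : Type} {γ : A → Set B} {γ' : A' → Set B'} {o : BotLift A}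
    {f : A → BotLift A'} {b : B} {b' : B'} (h : b ∈ gammaBot γ o)
    (hf : ∀ a, b ∈ γ a → b' ∈ gammaBot γ' (f a)) : b' ∈ gammaBot γ' (o.bind f) := by
  cases o with
  | none => exact h.elim
  | some a => exact hf a h

/-- Concretization of finite maps, as sets of total functions. -/
def gammaTree {A B : Type} (D : ADom A) (γ : A → Set B) (m : PTree A) : Set (ℕ → B) :=
  {f | ∀ k, f k ∈ γ ((m.find k).getD D.top)}

namespace ADom.Sound
variable {A A' B B' : Type} {D : ADom A} {D' : ADom A'} {γ : A → Set B}

theorem liftBot (h : D.Sound γ) : D.liftBot.Sound (gammaBot γ) where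
  gamma_monotone
    | none, _, _ => Set.empty_subset _
    | some _, none, hle => by simp [ADom.liftBot] at hle
    | some a, some b, hle => h.gamma_monotone a b hle
  top_sound := h.top_sound
  join_sound
    | none, none => by simp [gammaBot]
    | none, some _ => by simp [gammaBot, ADom.liftBot]
    | some _, none => by simp [gammaBot, ADom.liftBot]
    | some a, some b => h.join_sound a b

theorem prod {γ' : A' → Set B} (h : D.Sound γ) (h' : D'.Sound γ') :
    (D.prod D').Sound fun p => γ p.1 ∩ γ' p.2 where
  gamma_monotone a b hle := by
    obtain ⟨h₁, h₂⟩ := Bool.and_eq_true_iff.1 hle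
    exact Set.inter_subset_inter (h.gamma_monotone _ _ h₁) (h'.gamma_monotone _ _ h₂)
  top_sound x := ⟨h.top_sound x, h'.top_sound x⟩
  join_sound a b := by
    rintro x (⟨h₁, h₂⟩ | ⟨h₁, h₂⟩)
    · exact ⟨h.join_sound _ _ (.inl h₁), h'.join_sound _ _ (.inl h₂)⟩
    · exact ⟨h.join_sound _ _ (.inr h₁), h'.join_sound _ _ (.inr h₂)⟩

theorem tree (h : D.Sound γ) : D.tree.Sound (gammaTree D γ) where
  gamma_monotone a b hle f hf k := by
    cases hb : b.find k with
    | none => exact h.top_sound _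
    | some c => exact h.gamma_monotone _ _ (PTree.le_find hle hb) (hf k)
  top_sound f k := h.top_sound _
  join_sound a b f hf k := by
    change f k ∈ γ (((PTree.merge D.join a b).find k).getD D.top)
    cases hc : (PTree.merge D.join a b).find k with
    | none => exact h.top_sound _
    | some c =>
      obtain ⟨x, y, hx, hy, rfl⟩ := PTree.find_merge_eq_some hc
      refine h.join_sound x y (hf.imp (fun hf => ?_) fun hf => ?_)
      · simpa [hx] using hf k
      · simpa [hy] using hf k

/-- A relation `R` that is total on the left transports a concretization. -/
theorem preimage (h : D.Sound γ) (R : B' → B → Prop) (hR : ∀ x, ∃ y, R x y) :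
    D.Sound fun a => {x | ∃ y ∈ γ a, R x y} where
  gamma_monotone a b hle := by
    rintro x ⟨y, hy, hxy⟩
    exact ⟨y, h.gamma_monotone _ _ hle hy, hxy⟩
  top_sound x := (hR x).imp fun y hy => ⟨h.top_sound y, hy⟩
  join_sound a b := by
    rintro x (⟨y, hy, hxy⟩ | ⟨y, hy, hxy⟩)
    · exact ⟨y, h.join_sound _ _ (.inl hy), hxy⟩
    · exact ⟨y, h.join_sound _ _ (.inr hy), hxy⟩

end ADom.Sound

theorem mem_gammaTree_set {A B : Type} {D : ADom A} {γ : A → Set B} {m : PTree A} {f : ℕ → B}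
    (hf : f ∈ gammaTree D γ m) (x : ℕ) {a : A} {b : B} (hb : b ∈ γ a) :
    Function.update f x b ∈ gammaTree D γ (m.set x a) := by
  intro k
  rw [PTree.find_set]
  by_cases hk : k = x
  · subst hk; simpa using hb
  · simpa [hk] using hf k

theorem mem_gammaTree_remove {A B : Type} {D : ADom A} {γ : A → Set B} (h : D.Sound γ)
    {m : PTree A} {f : ℕ → B} (hf : f ∈ gammaTree D γ m) (x : ℕ) (b : B) :
    Function.update f x b ∈ gammaTree D γ (m.remove x) := by
  intro k
  rw [PTree.find_remove]
  by_cases hk : k = x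
  · subst hk; simpa using h.top_sound b
  · simpa [hk] using hf k

/-! ### From a sound memory domain to the reachable states -/

section Reach
variable {t : Type}

/-- The entry node is described by `top`, whatever the solver proposes. -/
theorem solvePfp_entry {D : ADom t} {γ : t → Set (Env × Mem)} (hD : D.Sound γ)
    (ext : Node → PTree Instr → Node → t) (code : PTree Instr) (entry : Node)
    (transfer : Node → Instr → List (Node × (t → t))) (s : Env × Mem) :
    s ∈ γ (solvePfp D ext code entry transfer D.top entry) := by
  unfold solvePfp
  split
  next h =>
    exact hD.gamma_monotone _ _ (Bool.and_eq_true_iff.1 h).1 (hD.top_sound s)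
  next => exact hD.top_sound s

/-- The validated solution is closed under the transformers of the edges, whatever the solver
proposes. -/
theorem solvePfp_edge {D : ADom t} {γ : t → Set (Env × Mem)} (hD : D.Sound γ)
    (ext : Node → PTree Instr → Node → t) {code : PTree Instr} (entry : Node)
    {transfer : Node → Instr → List (Node × (t → t))} {pc l : Node} {i : Instr} {f : t → t}
    (hi : code.find pc = some i) (hf : (l, f) ∈ transfer pc i) :
    γ (f (solvePfp D ext code entry transfer D.top pc)) ⊆
      γ (solvePfp D ext code entry transfer D.top l) := by
  unfold solvePfp
  split
  next h =>
    have h' := List.all_eq_true.1 (Bool.and_eq_true_iff.1 h).2 pc (PTree.mem_keys_of_find hi)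
    rw [hi] at h'
    exact hD.gamma_monotone _ _ (List.all_eq_true.1 h' _ hf)
  next => exact fun s _ => hD.top_sound s

/-- The abstract value from which `valueAnalysis` reads the ranges at a program point. -/
def solution (D : MemDom t) (ext : Node → PTree Instr → Node → t) (P : Program) (fn : Block)
    (pc : Node) : t :=
  match P.internalAt fn with
  | some f => solvePfp D.toADom ext f.code f.entry D.transfer D.top pc
  | none => D.top

theorem valueAnalysis_eq (D : MemDom t) (ext : Node → PTree Instr → Node → t) (P : Program)
    (l : ProgPoint) : valueAnalysis D ext P l = D.range (solution D ext P l.fn l.node) := by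
  unfold valueAnalysis solution
  cases P.internalAt l.fn <;> rfl

variable {D : MemDom t} {γ : t → Set (Env × Mem)} {C : Ctx}

theorem solution_edge (hD : D.toADom.Sound γ) (ext : Node → PTree Instr → Node → t)
    {P : Program} {fn : Block} {pc l : Node} {i : Instr} {f : t → t}
    (hi : P.instrAt fn pc = some i) (hf : (l, f) ∈ D.transfer pc i) :
    γ (f (solution D ext P fn pc)) ⊆ γ (solution D ext P fn l) := by
  obtain ⟨g, hg, hi⟩ := Option.bind_eq_some_iff.1 hi
  simp only [solution, hg]
  exact solvePfp_edge hD ext _ hi hf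

/-- The solution accounts for the return to a suspended caller, whatever the callee returns
and whatever it does to the memory. -/
def FrameOk (γ : t → Set (Env × Mem)) (sol : Block → Node → t) (F : Frame) : Prop :=
  ∀ v m, (F.env.setOpt F.res v, m) ∈ γ (sol F.fn F.pc)

/-- The invariant of execution: the solution at the current program point describes the current
environment and memory, and it accounts for all the pending returns. -/
def StateOk (γ : t → Set (Env × Mem)) (sol : Block → Node → t) : State → Prop
  | .regular stk fn _ pc E m => (E, m) ∈ γ (sol fn pc) ∧ ∀ F ∈ stk, FrameOk γ sol F
  | .call stk _ _ _ | .ret stk _ _ => ∀ F ∈ stk, FrameOk γ sol F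

theorem StateOk.step (hD : D.Sound C γ) (ext : Node → PTree Instr → Node → t) {σ σ' : State}
    (hs : Step C σ σ') (h : StateOk γ (solution D ext C.prog) σ) :
    StateOk γ (solution D ext C.prog) σ' := by
  have edge {fn pc l i f} := solution_edge (fn := fn) (pc := pc) (l := l) (i := i) (f := f)
    hD.toSound ext (P := C.prog)
  cases hs with
  | skip hi => exact ⟨edge hi (List.mem_singleton_self _) h.1, h.2⟩
  | assign hi hv =>
    exact ⟨edge hi (List.mem_singleton_self _)
      (hD.assign_sound _ _ _ ⟨_, _, _, h.1, hv, rfl⟩), h.2⟩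
  | store hi h₁ h₂ hm =>
    exact ⟨edge hi (List.mem_singleton_self _)
      (hD.store_sound _ _ _ _ ⟨_, _, _, _, h.1, h₁, h₂, hm⟩), h.2⟩
  | @ifThenElse _ _ _ _ _ _ _ _ _ v b hi hv hb =>
    refine ⟨?_, h.2⟩
    cases b with
    | true =>
      exact edge hi (List.mem_cons_self ..) (hD.assume_sound _ _ ⟨h.1, _, _, hv, hb⟩)
    | false =>
      refine edge hi (List.mem_cons_of_mem _ (List.mem_singleton_self _))
        (hD.assume_sound _ _ ⟨h.1, _, _, .unop hv, ?_⟩)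
      -- The `false` edge assumes the negation of the condition, which is then true.
      have : evalUnop .notbool v = vtrue := by
        cases v <;> simp_all [evalUnop, boolOfVal, ofOptBool, ofBool]
      rw [this]; rfl
  | call hi _ _ _ _ =>
    -- The edge is accounted for at the call, for every result and every final memory.
    refine List.forall_mem_cons.2 ⟨fun v m => ?_, h.2⟩
    exact edge hi (List.mem_singleton_self _) (hD.forget_sound _ _ ⟨_, _, _, h.1, rfl⟩)
  | retNone => exact h.2
  | retSome => exact h.2
  | enter hf _ =>
    refine ⟨?_, h⟩
    simp only [solution, hf]
    exact solvePfp_entry hD.toSound ..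
  | external => exact h
  | resume =>
    obtain ⟨h₁, h₂⟩ := List.forall_mem_cons.1 h
    exact ⟨h₁ _ _, h₂⟩

theorem stateOk_of_reach (hD : D.Sound C γ) (ext : Node → PTree Instr → Node → t) {σ : State}
    (hσ : σ ∈ Reach C) : StateOk γ (solution D ext C.prog) σ := by
  obtain ⟨σ₀, h₀, hσ⟩ := hσ
  induction hσ with
  | refl => cases h₀; exact fun F hF => nomatch hF
  | tail _ hs ih => exact ih.step hD ext hs

theorem valueAnalysis_sound (hD : D.Sound C γ) (ext : Node → PTree Instr → Node → t) {σ : State}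
    (hσ : σ ∈ Reach C) {l : ProgPoint} (hl : σ.point = some l) {x : Ident} {i : MInt}
    (hx : σ.env.Holds x i) : IntsInRange (valueAnalysis D ext C.prog l x) i := by
  have h := stateOk_of_reach hD ext hσ
  cases σ with
  | regular stk fn sp pc E m =>
    obtain rfl : ⟨fn, pc⟩ = l := by simpa [State.point] using hl
    rw [valueAnalysis_eq]
    exact hD.range_sound _ _ _ _ _ h.1 hx
  | _ => simp [State.point] at hl

end Reach

/-! ### Numerical operators on machine integers -/

/-- Unary operators on the numerical view of values, in which a pointer is its offset. -/
def UnOp.num : UnOp → MInt → MInt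
  | .cast8unsigned, n => zeroExt 8 n
  | .cast8signed, n => signExt 8 n
  | .cast16unsigned, n => zeroExt 16 n
  | .cast16signed, n => signExt 16 n
  | .boolval, n => if n = 0 then 0 else 1
  | .notbool, n => if n = 0 then 1 else 0
  | .negint, n => -n
  | .notint, n => ~~~n

/-- The integer that stands for a Boolean. -/
def bit (b : Bool) : MInt := if b then 1 else 0

/-- Binary operators on the numerical view of values. They are undefined where the execution gets
stuck; where the operator of the language returns `undef` (an excessive shift amount, for
example), they return some integer. -/
def BinOp.num : BinOp → MInt → MInt → Option MInt
  | .add, x, y => some (x + y)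
  | .sub, x, y => some (x - y)
  | .mul, x, y => some (x * y)
  | .div, x, y =>
    if signedDivError x y then none else some (BitVec.ofInt 32 ((signed x).tdiv (signed y)))
  | .mod, x, y =>
    if signedDivError x y then none else some (BitVec.ofInt 32 ((signed x).tmod (signed y)))
  | .divu, x, y => if y = 0 then none else some (BitVec.ofNat 32 (x.toNat / y.toNat))
  | .modu, x, y => if y = 0 then none else some (BitVec.ofNat 32 (x.toNat % y.toNat))
  | .shl, x, y => some (x <<< y.toNat)
  | .shr, x, y => some (x.sshiftRight y.toNat)
  | .shru, x, y => some (x >>> y.toNat)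
  | .and, x, y => some (x &&& y)
  | .or, x, y => some (x ||| y)
  | .xor, x, y => some (x ^^^ y)
  | .cmp c, x, y => some (bit (c.test (signed x) (signed y)))
  | .cmpu c, x, y => some (bit (c.test (unsigned x) (unsigned y)))

theorem signed_eq_toInt (n : MInt) : signed n = n.toInt := by
  rw [signed, unsigned, BitVec.toInt_eq_toNat_cond]
  split <;> split <;> omega

namespace SignFlag

theorem ofInt_val (s : SignFlag) (n : MInt) : BitVec.ofInt 32 (s.val n) = n := by
  cases s
  · simp [val, signed_eq_toInt]
  · simp [val, CFG.unsigned]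

theorem val_injective (s : SignFlag) : Function.Injective s.val :=
  Function.LeftInverse.injective s.ofInt_val

theorem val_mem_top (s : SignFlag) (n : MInt) :
    (Itv.top s).min ≤ s.val n ∧ s.val n ≤ (Itv.top s).max := by
  have := n.isLt
  cases s <;>
    simp only [Itv.top, val, CFG.signed, CFG.unsigned, minSigned, maxSigned, maxUnsigned] <;> grind

theorem val_ofInt {s : SignFlag} {x : ℤ} (h : (Itv.top s).min ≤ x ∧ x ≤ (Itv.top s).max) :
    s.val (BitVec.ofInt 32 x) = x := by
  cases s <;>
    simp only [Itv.top, val, CFG.signed, CFG.unsigned, minSigned, maxSigned, maxUnsigned,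
      BitVec.toNat_ofInt] at h ⊢ <;>
    grind

theorem val_zero (s : SignFlag) : s.val 0 = 0 := by cases s <;> decide
theorem val_one (s : SignFlag) : s.val 1 = 1 := by cases s <;> decide

theorem val_eq_zero {s : SignFlag} {n : MInt} : s.val n = 0 ↔ n = 0 := by
  rw [← s.val_zero, s.val_injective.eq_iff]

theorem val_eq_toNat {s : SignFlag} {n : MInt} (h : 0 ≤ s.val n) : s.val n = n.toNat := by
  have := n.isLt
  cases s <;> simp only [val, CFG.signed, CFG.unsigned] at h ⊢
  grind

theorem ofInt_sub (x y : ℤ) : BitVec.ofInt 32 (x - y) = BitVec.ofInt 32 x - BitVec.ofInt 32 y := by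
  rw [sub_eq_add_neg, BitVec.ofInt_add, BitVec.ofInt_neg, ← BitVec.sub_eq_add_neg]

end SignFlag

/-! ### Soundness of the interval operators -/

/-- A product with one factor in an interval lies between the products with its bounds. -/
theorem mul_between {a b u v : ℤ} (h₁ : a ≤ u) (h₂ : u ≤ b) :
    min (a * v) (b * v) ≤ u * v ∧ u * v ≤ max (a * v) (b * v) := by
  rcases le_total 0 v with hv | hv
  · exact ⟨min_le_of_left_le (mul_le_mul_of_nonneg_right h₁ hv),
      le_max_of_le_right (mul_le_mul_of_nonneg_right h₂ hv)⟩
  · exact ⟨min_le_of_right_le (mul_le_mul_of_nonpos_right h₂ hv),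
      le_max_of_le_left (mul_le_mul_of_nonpos_right h₁ hv)⟩

/-- Truncated division by a positive divisor in an interval lies between the quotients by the
bounds of the interval. -/
theorem tdiv_between {u a b v : ℤ} (ha : 0 < a) (h₁ : a ≤ v) (h₂ : v ≤ b) :
    min (u.tdiv a) (u.tdiv b) ≤ u.tdiv v ∧ u.tdiv v ≤ max (u.tdiv a) (u.tdiv b) := by
  have key {w : ℤ} (hw : 0 ≤ w) : w.tdiv b ≤ w.tdiv v ∧ w.tdiv v ≤ w.tdiv a := by
    simp only [Int.tdiv_eq_ediv_of_nonneg hw]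
    lift w to ℕ using hw
    lift a to ℕ using ha.le
    lift v to ℕ using by omega
    lift b to ℕ using by omega
    norm_cast at *
    exact ⟨Nat.div_le_div_left h₂ (by omega), Nat.div_le_div_left h₁ ha⟩
  rcases le_total 0 u with hu | hu
  · have := key hu
    omega
  · have := key (neg_nonneg.2 hu)
    simp only [Int.neg_tdiv] at this
    omega

/-- Bounds of the truncated remainder of a nonnegative number by a positive divisor. -/
theorem tmod_bounds {u v : ℤ} (hu : 0 ≤ u) (hv : 0 < v) :
    0 ≤ u.tmod v ∧ u.tmod v ≤ u ∧ u.tmod v < v := by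
  rw [Int.tmod_eq_emod_of_nonneg hu]
  lift u to ℕ using hu
  lift v to ℕ using hv.le
  norm_cast at *
  exact ⟨Nat.zero_le _, Nat.mod_le _ _, Nat.mod_lt _ hv⟩

namespace Itv
variable {s q : SignFlag} {i j z : Itv} {n x y : MInt}

/-- Concretization of an interval. -/
abbrev conc (s : SignFlag) (i : Itv) : Set MInt := gamma s (some i)

theorem gammaBot_conc : gammaBot (conc s) = gamma s := by
  ext o; cases o <;> rfl

theorem mem_conc : n ∈ conc s i ↔ i.min ≤ s.val n ∧ s.val n ≤ i.max := Iff.rfl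

theorem conc_top (n : MInt) : n ∈ conc s (top s) := s.val_mem_top n

theorem conc_mono (h : le i j = true) : conc s i ⊆ conc s j := by
  intro n hn
  simp only [le, decide_eq_true_eq] at h
  exact ⟨h.1.trans hn.1, hn.2.trans h.2⟩

theorem adom_sound (s : SignFlag) : (adom s).Sound (conc s) where
  gamma_monotone _ _ := conc_mono
  top_sound := conc_top
  join_sound i j := by
    rintro n (h | h) <;> simp only [adom, join, mem_conc] at h ⊢ <;> omega

theorem mem_reduce {a b : ℤ} (h : a ≤ s.val n ∧ s.val n ≤ b) : n ∈ gamma s (reduce a b) := by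
  rw [reduce, if_pos (h.1.trans h.2)]
  exact h

theorem mem_meet (hi : n ∈ conc s i) (hj : n ∈ conc s j) : n ∈ gamma s (meet i j) :=
  mem_reduce ⟨max_le hi.1 hj.1, le_min hi.2 hj.2⟩

/-- The source of the soundness of the arithmetic operators: either the interval fits the machine
integers, and `k` does not wrap around, or `repr` gives up. -/
theorem mem_repr {k : ℤ} (h : i.min ≤ k ∧ k ≤ i.max) : BitVec.ofInt 32 k ∈ conc s (repr s i) := by
  unfold repr
  split
  next hle =>
    simp only [le, decide_eq_true_eq] at hle
    rwa [mem_conc, SignFlag.val_ofInt ⟨hle.1.trans h.1, h.2.trans hle.2⟩]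
  next => exact conc_top _

theorem mem_repr_of_eq {k : ℤ} (hn : n = BitVec.ofInt 32 k) (h : i.min ≤ k ∧ k ≤ i.max) :
    n ∈ conc s (repr s i) := hn ▸ mem_repr h

/-- Changing the interpretation of an interval loses no integer. -/
theorem mem_convert (h : n ∈ conc s i) : n ∈ conc q (convert s q i) := by
  have := n.isLt
  have htop := conc_top (s := q) n
  rw [mem_conc] at h
  cases s <;> cases q <;> simp only [convert]
  · exact h
  · split
    · simp only [mem_conc, SignFlag.val, signed, unsigned] at *; grind
    · split
      · simp only [mem_conc, SignFlag.val, signed, unsigned] at *; grind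
      · exact htop
  · split
    · simp only [mem_conc, SignFlag.val, signed, unsigned, maxSigned] at *; grind
    · split
      · simp only [mem_conc, SignFlag.val, signed, unsigned, maxSigned] at *; grind
      · exact htop
  · exact h

theorem val_eq_of_agree (ha : agree s q i = true) (h : n ∈ conc s i) : q.val n = s.val n := by
  have := n.isLt
  rw [mem_conc] at h
  cases s <;> cases q <;>
    simp only [agree, decide_eq_true_eq, SignFlag.val, signed, unsigned, maxSigned] at * <;> grind

theorem nonzero_ne (hz : i.nonzero = true) (h : n ∈ conc s i) : n ≠ 0 := by
  rw [Ne, ← SignFlag.val_eq_zero (s := s)]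
  simp only [nonzero, decide_eq_true_eq, mem_conc] at hz h
  omega

theorem isZero_eq (hz : i.isZero = true) (h : n ∈ conc s i) : n = 0 := by
  rw [← SignFlag.val_eq_zero (s := s)]
  simp only [isZero, decide_eq_true_eq, mem_conc] at hz h
  omega

theorem mem_singleton_val : n ∈ conc s (singleton (s.val n)) := ⟨le_rfl, le_rfl⟩

theorem zero_mem : (0 : MInt) ∈ conc s (singleton 0) := ⟨s.val_zero.ge, s.val_zero.le⟩
theorem one_mem : (1 : MInt) ∈ conc s (singleton 1) := ⟨s.val_one.ge, s.val_one.le⟩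
theorem zero_mem_bool : (0 : MInt) ∈ conc s ⟨0, 1⟩ :=
  ⟨s.val_zero.ge, s.val_zero.trans_le zero_le_one⟩
theorem one_mem_bool : (1 : MInt) ∈ conc s ⟨0, 1⟩ :=
  ⟨zero_le_one.trans s.val_one.ge, s.val_one.le⟩

theorem bit_mem_bool (b : Bool) : bit b ∈ conc s ⟨0, 1⟩ := by
  cases b
  · exact zero_mem_bool
  · exact one_mem_bool

theorem boolval_sound (h : n ∈ conc s i) : UnOp.boolval.num n ∈ conc s (boolval i) := by
  unfold boolval
  simp only [UnOp.num]
  split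
  next hz => rw [if_neg (nonzero_ne hz h)]; exact one_mem
  split
  next hz => rw [if_pos (isZero_eq hz h)]; exact zero_mem
  split
  · exact zero_mem_bool
  · exact one_mem_bool

theorem notbool_sound (h : n ∈ conc s i) : UnOp.notbool.num n ∈ conc s (notbool i) := by
  unfold notbool
  simp only [UnOp.num]
  split
  next hz => rw [if_neg (nonzero_ne hz h)]; exact zero_mem
  split
  next hz => rw [if_pos (isZero_eq hz h)]; exact one_mem
  split
  · exact one_mem_bool
  · exact zero_mem_bool

theorem zeroExt_toNat {k : ℕ} (hk : k ≤ 32) (n : MInt) : (zeroExt k n).toNat = n.toNat % 2 ^ k := by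
  have h : n.toNat % 2 ^ k < 2 ^ 32 :=
    (Nat.mod_lt _ (by positivity)).trans_le (Nat.pow_le_pow_right (by norm_num) hk)
  simp only [zeroExt, BitVec.toNat_setWidth]
  exact Nat.mod_eq_of_lt h

theorem castUnsigned_sound {k : ℕ} (hk : k < 32) (h : n ∈ conc s i) :
    zeroExt k n ∈ conc s (castUnsigned k i) := by
  have hpow : 2 ^ k ≤ 2 ^ 31 := Nat.pow_le_pow_right (by norm_num) (by omega)
  have hlt := Nat.mod_lt n.toNat (show 2 ^ k > 0 by positivity)
  have hz := zeroExt_toNat hk.le n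
  have hcast : ((2 ^ k : ℕ) : ℤ) = 2 ^ k := by push_cast; rfl
  unfold castUnsigned
  split
  next hle =>
    simp only [le, decide_eq_true_eq] at hle
    rw [mem_conc] at h
    have hn := SignFlag.val_eq_toNat (s := s) (n := n) (hle.1.trans h.1)
    have : zeroExt k n = n := BitVec.eq_of_toNat_eq (by rw [hz, Nat.mod_eq_of_lt]; omega)
    rwa [this]
  next =>
    have : s.val (zeroExt k n) = (n.toNat % 2 ^ k : ℕ) := by
      cases s <;> simp only [SignFlag.val, signed, unsigned, hz]
      split <;> omega
    rw [mem_conc, this]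
    constructor <;> simp only <;> omega

theorem castSigned_sound {k : ℕ} (hk₀ : 0 < k) (hk : k < 32) (h : n ∈ conc s i) :
    signExt k n ∈ conc s (castSigned s k i) := by
  have hpow : (2 : ℤ) ^ (k - 1) ≤ 2 ^ 31 := pow_le_pow_right₀ (by norm_num) (by omega)
  have h2 : (2 : ℤ) ^ k = 2 * 2 ^ (k - 1) := by
    rw [← pow_succ']; congr; omega
  have hpos : (0 : ℤ) < 2 ^ (k - 1) := by positivity
  have hsx : (signExt k n).toInt = (n.toNat : ℤ).bmod (2 ^ k) := by
    rw [signExt, BitVec.toInt_signExtend_of_le hk.le, BitVec.toInt_setWidth]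
  unfold castSigned
  split
  next hle =>
    simp only [le, decide_eq_true_eq] at hle
    rw [mem_conc] at h
    have hn : n.toInt = s.val n := by
      have := n.isLt
      rw [← signed_eq_toInt]
      cases s <;> simp only [SignFlag.val, signed, unsigned] at h ⊢
      grind
    have : signExt k n = n := by
      refine BitVec.eq_of_toInt_eq ?_
      rw [hsx, ← Int.bmod_bmod_of_dvd (pow_dvd_pow 2 hk.le), ← BitVec.toInt_eq_toNat_bmod]
      exact Int.bmod_eq_of_le (by push_cast; omega) (by push_cast; omega)
    rwa [this]
  next =>
    refine mem_repr_of_eq (k := (signExt k n).toInt) (by simp) ?_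
    rw [hsx]
    have hc : ((2 ^ k : ℕ) : ℤ) = 2 ^ k := by push_cast; rfl
    have h₁ := Int.le_bmod (x := n.toNat) (m := 2 ^ k) (by positivity)
    have h₂ := Int.bmod_lt (x := n.toNat) (m := 2 ^ k) (by positivity)
    constructor <;> simp only <;> omega

theorem notint_eq (s : SignFlag) (n : MInt) :
    ~~~n = BitVec.ofInt 32 ((top s).min + (top s).max - s.val n) := by
  rw [SignFlag.ofInt_sub, s.ofInt_val, BitVec.not_eq_neg_add]
  have : BitVec.ofInt 32 ((top s).min + (top s).max) = -1 := by cases s <;> rfl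
  rw [this]
  abel

theorem forwardUnop_sound (op : UnOp) (h : n ∈ conc s i) :
    op.num n ∈ conc s (forwardUnop s op i) := by
  cases op with
  | cast8unsigned => exact castUnsigned_sound (by norm_num) h
  | cast8signed => exact castSigned_sound (by norm_num) (by norm_num) h
  | cast16unsigned => exact castUnsigned_sound (by norm_num) h
  | cast16signed => exact castSigned_sound (by norm_num) (by norm_num) h
  | boolval => exact boolval_sound h
  | notbool => exact notbool_sound h
  | negint =>
    refine mem_repr_of_eq (k := - s.val n) (by rw [BitVec.ofInt_neg, s.ofInt_val]; rfl) ?_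
    exact ⟨neg_le_neg h.2, neg_le_neg h.1⟩
  | notint => exact mem_repr_of_eq (notint_eq s n) ⟨sub_le_sub_left h.2 _, sub_le_sub_left h.1 _⟩

theorem add_sound (hx : x ∈ conc s i) (hy : y ∈ conc s j) : x + y ∈ conc s (add s i j) :=
  mem_repr_of_eq (k := s.val x + s.val y) (by simp [BitVec.ofInt_add, s.ofInt_val])
    ⟨add_le_add hx.1 hy.1, add_le_add hx.2 hy.2⟩

theorem sub_sound (hx : x ∈ conc s i) (hy : y ∈ conc s j) : x - y ∈ conc s (sub s i j) :=
  mem_repr_of_eq (k := s.val x - s.val y) (by simp [SignFlag.ofInt_sub, s.ofInt_val])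
    ⟨sub_le_sub hx.1 hy.2, sub_le_sub hx.2 hy.1⟩

theorem mul_sound (hx : x ∈ conc s i) (hy : y ∈ conc s j) : x * y ∈ conc s (mul s i j) := by
  refine mem_repr_of_eq (k := s.val x * s.val y) (by simp [BitVec.ofInt_mul, s.ofInt_val]) ?_
  have h := mul_between (v := s.val y) hx.1 hx.2
  have h₁ := mul_between (v := i.min) hy.1 hy.2
  have h₂ := mul_between (v := i.max) hy.1 hy.2
  simp only [mul_comm _ i.min, mul_comm _ i.max] at h h₁ h₂
  simp only
  omega

theorem div_sound (hx : x ∈ conc s i) (hy : y ∈ conc s j) :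
    BitVec.ofInt 32 ((q.val x).tdiv (q.val y)) ∈ conc s (div s q i j) := by
  unfold div
  split
  next h =>
    simp only [Bool.and_eq_true, decide_eq_true_eq] at h
    obtain ⟨⟨hi, hj⟩, hpos⟩ := h
    rw [val_eq_of_agree hi hx, val_eq_of_agree hj hy]
    refine mem_repr ?_
    rw [mem_conc] at hx hy
    have hy' : 0 < s.val y := by omega
    have h₁ := Int.tdiv_le_tdiv hy' hx.1
    have h₂ := Int.tdiv_le_tdiv hy' hx.2
    have h₃ := tdiv_between (u := i.min) hpos hy.1 hy.2
    have h₄ := tdiv_between (u := i.max) hpos hy.1 hy.2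
    simp only
    omega
  next => exact conc_top _

theorem mod_sound (hx : x ∈ conc s i) (hy : y ∈ conc s j) :
    BitVec.ofInt 32 ((q.val x).tmod (q.val y)) ∈ conc s (mod s q i j) := by
  unfold mod
  split
  next h =>
    simp only [Bool.and_eq_true, decide_eq_true_eq] at h
    obtain ⟨⟨hi, hj⟩, hpos⟩ := h
    rw [val_eq_of_agree hi hx, val_eq_of_agree hj hy]
    refine mem_repr ?_
    rw [mem_conc] at hx hy
    have hy' : 0 < s.val y := by omega
    simp only
    rcases le_total 0 (s.val x) with hw | hw
    · have := tmod_bounds hw hy'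
      constructor <;> split <;> omega
    · have := tmod_bounds (neg_nonneg.2 hw) hy'
      rw [Int.neg_tmod] at this
      constructor <;> split <;> omega
  next => exact conc_top _

/-- A known shift amount is below 32, so both interpretations read it in the same way. -/
theorem shiftAmount_eq {k : ℕ} (h : shiftAmount j = some k) (hy : y ∈ conc s j) :
    y.toNat = k := by
  unfold shiftAmount at h
  split at h
  next hj =>
    rw [mem_conc] at hy
    have := SignFlag.val_eq_toNat (s := s) (n := y) (by omega)
    simp only [Option.some.injEq] at h
    omega
  next => simp at h

theorem shl_sound (hx : x ∈ conc s i) (hy : y ∈ conc s j) :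
    x <<< y.toNat ∈ conc s (shl s i j) := by
  unfold shl
  split
  next k hk =>
    rw [shiftAmount_eq hk hy]
    refine mem_repr_of_eq (k := s.val x * 2 ^ k) ?_ ?_
    · rw [BitVec.ofInt_mul, s.ofInt_val, BitVec.shiftLeft_eq_mul_twoPow]
      congr 1
      refine BitVec.eq_of_toNat_eq ?_
      rw [BitVec.toNat_twoPow, ← BitVec.toNat_ofNat, ← BitVec.ofInt_natCast]
      push_cast
      rfl
    · exact ⟨mul_le_mul_of_nonneg_right hx.1 (by positivity),
        mul_le_mul_of_nonneg_right hx.2 (by positivity)⟩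
  next => exact conc_top _

/-- Right shift, arithmetic or logical according to `q`. -/
theorem shr_sound (hx : x ∈ conc s i) (hy : y ∈ conc s j)
    (hn : n = BitVec.ofInt 32 (q.val x / 2 ^ y.toNat)) : n ∈ conc s (shr s q i j) := by
  unfold shr
  split
  next k hk =>
    split
    next ha =>
      rw [shiftAmount_eq hk hy, val_eq_of_agree ha hx] at hn
      exact mem_repr_of_eq hn
        ⟨Int.ediv_le_ediv (by positivity) hx.1, Int.ediv_le_ediv (by positivity) hx.2⟩
    next => exact conc_top _
  next => exact conc_top _

theorem and_sound (hx : x ∈ conc s i) (hy : y ∈ conc s j) : x &&& y ∈ conc s (and s i j) := by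
  unfold and
  split
  next h =>
    have hx' := SignFlag.val_eq_toNat (h.1.trans hx.1)
    have hy' := SignFlag.val_eq_toNat (h.2.trans hy.1)
    refine mem_repr_of_eq (k := (x &&& y).toNat) (by simp) ?_
    rw [mem_conc] at hx hy
    have h₁ : (x &&& y).toNat ≤ x.toNat := by rw [BitVec.toNat_and]; exact Nat.and_le_left
    have h₂ : (x &&& y).toNat ≤ y.toNat := by rw [BitVec.toNat_and]; exact Nat.and_le_right
    simp only
    omega
  next => exact conc_top _

/-- Bitwise disjunction, inclusive or exclusive: all that matters is that the result has no more
bits than the operands. -/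
theorem or_sound {r : MInt} (hx : x ∈ conc s i) (hy : y ∈ conc s j)
    (hr : ∀ k, x.toNat < 2 ^ k → y.toNat < 2 ^ k → r.toNat < 2 ^ k) : r ∈ conc s (or s i j) := by
  unfold or
  split
  next h =>
    have hx' := SignFlag.val_eq_toNat (h.1.trans hx.1)
    have hy' := SignFlag.val_eq_toNat (h.2.trans hy.1)
    refine mem_repr_of_eq (k := r.toNat) (by simp) ?_
    rw [mem_conc] at hx hy
    have hlt := Nat.lt_size_self (Max.max i.max j.max).toNat
    have := hr (Nat.size (Max.max i.max j.max).toNat) (by omega) (by omega)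
    zify at this
    simp only
    omega
  next => exact conc_top _

end Itv

theorem Comparison.test_negate (c : Comparison) (x y : ℤ) : c.negate.test x y = !c.test x y := by
  rw [Bool.eq_iff_iff]
  cases c <;> simp [negate, test]

namespace Itv
variable {s q : SignFlag} {i j z : Itv} {n x y : MInt}

theorem mustHold_test {c : Comparison} (h : mustHold c i j = true) (hx : x ∈ conc s i)
    (hy : y ∈ conc s j) : c.test (s.val x) (s.val y) = true := by
  rw [mem_conc] at hx hy
  cases c <;> simp only [mustHold, Comparison.test, decide_eq_true_eq] at h ⊢ <;> omega

/-- Equality tests do not depend on the interpretation, since both are injective; the order tests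
do not either where both interpretations coincide. -/
theorem test_eq_of_cmpAgree {c : Comparison} (h : cmpAgree s q c i j = true) (hx : x ∈ conc s i)
    (hy : y ∈ conc s j) : c.test (q.val x) (q.val y) = c.test (s.val x) (s.val y) := by
  simp only [cmpAgree, Bool.or_eq_true, beq_iff_eq, Bool.and_eq_true] at h
  rcases h with (rfl | rfl) | h
  · simp [Comparison.test, (SignFlag.val_injective _).eq_iff]
  · simp [Comparison.test, (SignFlag.val_injective _).eq_iff]
  · rw [val_eq_of_agree h.1 hx, val_eq_of_agree h.2 hy]

theorem cmp_sound (c : Comparison) (hx : x ∈ conc s i) (hy : y ∈ conc s j) :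
    bit (c.test (q.val x) (q.val y)) ∈ conc s (cmp s q c i j) := by
  unfold cmp
  split
  next ha =>
    rw [test_eq_of_cmpAgree ha hx hy]
    split
    next h => rw [mustHold_test h hx hy]; exact one_mem
    split
    next h =>
      have := mustHold_test h hx hy
      rw [Comparison.test_negate, Bool.not_eq_true'] at this
      rw [this]
      exact zero_mem
    next => exact bit_mem_bool _
  next => exact bit_mem_bool _

theorem forwardBinop_sound (op : BinOp) {r : MInt} (hx : x ∈ conc s i) (hy : y ∈ conc s j)
    (hr : op.num x y = some r) : r ∈ conc s (forwardBinop s op i j) := by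
  cases op <;> simp only [BinOp.num, Option.some.injEq, Option.ite_none_left_eq_some] at hr
  case add => exact hr ▸ add_sound hx hy
  case sub => exact hr ▸ sub_sound hx hy
  case mul => exact hr ▸ mul_sound hx hy
  case div => exact hr.2 ▸ div_sound (q := .signed) hx hy
  case mod => exact hr.2 ▸ mod_sound (q := .signed) hx hy
  case divu =>
    have := div_sound (q := .unsigned) hx hy
    rwa [SignFlag.val, unsigned, unsigned, ← Int.ofNat_tdiv, BitVec.ofInt_natCast, hr.2] at this
  case modu =>
    have := mod_sound (q := .unsigned) hx hy
    rwa [SignFlag.val, unsigned, unsigned, ← Int.ofNat_tmod, BitVec.ofInt_natCast, hr.2] at this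
  case shl => exact hr ▸ shl_sound hx hy
  case shr =>
    refine shr_sound (q := .signed) hx hy ?_
    have := Int.shiftRight_eq_div_pow x.toInt y.toNat
    push_cast at this
    rw [← hr, SignFlag.val, signed_eq_toInt, ← this, ← BitVec.toInt_sshiftRight,
      BitVec.ofInt_toInt]
  case shru =>
    refine shr_sound (q := .unsigned) hx hy ?_
    rw [← hr, SignFlag.val, unsigned]
    refine BitVec.eq_of_toNat_eq ?_
    have : (x.toNat : ℤ) / 2 ^ y.toNat = (x.toNat / 2 ^ y.toNat : ℕ) := by push_cast; rfl
    rw [this, BitVec.ofInt_natCast, BitVec.toNat_ofNat, BitVec.toNat_ushiftRight,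
      Nat.shiftRight_eq_div_pow, Nat.mod_eq_of_lt ((Nat.div_le_self ..).trans_lt x.isLt)]
  case and => exact hr ▸ and_sound hx hy
  case or =>
    refine or_sound hx hy fun k h₁ h₂ => ?_
    rw [← hr, BitVec.toNat_or]
    exact Nat.or_lt_two_pow h₁ h₂
  case xor =>
    refine or_sound hx hy fun k h₁ h₂ => ?_
    rw [← hr, BitVec.toNat_xor]
    exact Nat.xor_lt_two_pow h₁ h₂
  case cmp c => exact hr ▸ cmp_sound (q := .signed) c hx hy
  case cmpu c => exact hr ▸ cmp_sound (q := .unsigned) c hx hy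

theorem mem_remove {k : ℤ} (h : n ∈ conc s i) (hk : s.val n ≠ k) : n ∈ gamma s (remove k i) := by
  rw [mem_conc] at h
  unfold remove
  split
  · exact mem_reduce (by omega)
  split
  · exact mem_reduce (by omega)
  · exact h

theorem mem_remove_zero (h : n ∈ conc s i) (hn : n ≠ 0) : n ∈ gamma s (remove 0 i) :=
  mem_remove h (mt SignFlag.val_eq_zero.1 hn)

theorem mem_meet_zero (h : n ∈ conc s i) (hn : n = 0) :
    n ∈ gamma s (meet i (singleton 0)) := mem_meet h (hn ▸ zero_mem)

/-- The operand survives the refinement by a set `z` that contains the result. -/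
theorem backwardUnop_sound (op : UnOp) (h : n ∈ conc s i) (hz : op.num n ∈ conc s z) :
    n ∈ gamma s (backwardUnop s op i z) := by
  cases op with
  | boolval =>
    simp only [backwardUnop]
    split
    next hnz =>
      refine mem_remove_zero h fun h0 => nonzero_ne hnz hz ?_
      simp [UnOp.num, h0]
    split
    next h0 =>
      refine mem_meet_zero h (by_contra fun hn => ?_)
      have := isZero_eq h0 hz
      simp only [UnOp.num, if_neg hn] at this
      exact absurd this (by decide)
    next => exact h
  | notbool =>
    simp only [backwardUnop]
    split
    next hnz =>
      refine mem_meet_zero h (by_contra fun hn => nonzero_ne hnz hz ?_)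
      simp only [UnOp.num, if_neg hn]
    split
    next h0 =>
      refine mem_remove_zero h fun hn => ?_
      simpa [UnOp.num, hn] using isZero_eq h0 hz
    next => exact h
  | negint =>
    refine mem_meet h ?_
    simpa [UnOp.num] using forwardUnop_sound .negint hz
  | notint =>
    refine mem_meet h ?_
    simpa [UnOp.num] using forwardUnop_sound .notint hz
  | _ => exact h

theorem backwardLt_sound (hx : x ∈ conc s i) (hy : y ∈ conc s j) (h : s.val x < s.val y) :
    x ∈ gamma s (backwardLt s i j).1 ∧ y ∈ gamma s (backwardLt s i j).2 := by
  have hx' := s.val_mem_top x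
  have hy' := s.val_mem_top y
  refine ⟨mem_meet hx ?_, mem_meet hy ?_⟩ <;> rw [mem_conc] at * <;> simp only <;> omega

theorem backwardLe_sound (hx : x ∈ conc s i) (hy : y ∈ conc s j) (h : s.val x ≤ s.val y) :
    x ∈ gamma s (backwardLe s i j).1 ∧ y ∈ gamma s (backwardLe s i j).2 := by
  have hx' := s.val_mem_top x
  have hy' := s.val_mem_top y
  refine ⟨mem_meet hx ?_, mem_meet hy ?_⟩ <;> rw [mem_conc] at * <;> simp only <;> omega

theorem backwardCmp_sound {c : Comparison} (hx : x ∈ conc s i) (hy : y ∈ conc s j)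
    (h : c.test (s.val x) (s.val y) = true) :
    x ∈ gamma s (backwardCmp s c i j).1 ∧ y ∈ gamma s (backwardCmp s c i j).2 := by
  cases c <;> simp only [Comparison.test, decide_eq_true_eq] at h
  case lt => exact backwardLt_sound hx hy h
  case le => exact backwardLe_sound hx hy h
  case gt => exact (backwardLt_sound hy hx h).symm
  case ge => exact (backwardLe_sound hy hx h).symm
  case eq =>
    obtain rfl := s.val_injective h
    exact ⟨mem_meet hx hy, mem_meet hx hy⟩
  case ne =>
    simp only [backwardCmp]
    refine ⟨?_, ?_⟩ <;> split
    · exact mem_remove hx (by rw [mem_conc] at hy; omega)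
    · exact hx
    · exact mem_remove hy (by rw [mem_conc] at hx; omega)
    · exact hy

theorem backwardTest_sound {c : Comparison} (hx : x ∈ conc s i) (hy : y ∈ conc s j)
    (hz : bit (c.test (q.val x) (q.val y)) ∈ conc s z) :
    x ∈ gamma s (backwardTest s q c i j z).1 ∧ y ∈ gamma s (backwardTest s q c i j z).2 := by
  simp only [backwardTest]
  split
  next h =>
    simp only [Bool.and_eq_true] at h
    refine backwardCmp_sound hx hy ?_
    rw [← test_eq_of_cmpAgree h.2 hx hy]
    by_contra ht
    exact nonzero_ne h.1 hz (by simp [bit, ht])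
  split
  next h =>
    simp only [Bool.and_eq_true] at h
    refine backwardCmp_sound hx hy ?_
    rw [← test_eq_of_cmpAgree h.2 hx hy, Comparison.test_negate, Bool.not_eq_true']
    by_contra ht
    simpa [bit, ht] using isZero_eq h.1 hz
  next => exact ⟨hx, hy⟩

/-- Both operands survive the refinement by a set `z` that contains the result. -/
theorem backwardBinop_sound (op : BinOp) {r : MInt} (hx : x ∈ conc s i) (hy : y ∈ conc s j)
    (hr : op.num x y = some r) (hz : r ∈ conc s z) :
    x ∈ gamma s (backwardBinop s op i j z).1 ∧ y ∈ gamma s (backwardBinop s op i j z).2 := by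
  cases op with
  | add =>
    obtain rfl : x + y = r := by simpa [BinOp.num] using hr
    exact ⟨mem_meet hx (by simpa using sub_sound hz hy),
      mem_meet hy (by simpa using sub_sound hz hx)⟩
  | sub =>
    obtain rfl : x - y = r := by simpa [BinOp.num] using hr
    exact ⟨mem_meet hx (by simpa using add_sound hz hy),
      mem_meet hy (by simpa using sub_sound hx hz)⟩
  | cmp c =>
    simp only [BinOp.num, Option.some.injEq] at hr
    subst hr
    exact backwardTest_sound (q := .signed) hx hy hz
  | cmpu c =>
    simp only [BinOp.num, Option.some.injEq] at hr
    subst hr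
    exact backwardTest_sound (q := .unsigned) hx hy hz
  | _ => exact ⟨hx, hy⟩

end Itv

/-! ### Laws of numerical domains and reduced product -/

/-- The laws of a numerical domain with concretization `γ`. -/
structure NumDom.Sound {t : Type} (N : NumDom t) (γ : t → Set MInt) : Prop
    extends N.toADom.Sound γ where
  meet_sound : ∀ {a b n}, n ∈ γ a → n ∈ γ b → n ∈ gammaBot γ (N.meet a b)
  range_sound : ∀ {a n}, n ∈ γ a → ∀ s, n ∈ Itv.gamma s (N.range a s)
  const_sound : ∀ n, n ∈ γ (N.const n)
  forwardUnop_sound : ∀ op {a n}, n ∈ γ a → op.num n ∈ gammaBot γ (N.forwardUnop op a)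
  forwardBinop_sound : ∀ op {a b x y r}, x ∈ γ a → y ∈ γ b → op.num x y = some r →
    r ∈ gammaBot γ (N.forwardBinop op a b)
  backwardUnop_sound : ∀ op {a z n}, n ∈ γ a → op.num n ∈ γ z →
    n ∈ gammaBot γ (N.backwardUnop op a z)
  backwardBinop_sound : ∀ op {a b z x y r}, x ∈ γ a → y ∈ γ b → op.num x y = some r → r ∈ γ z →
    x ∈ gammaBot γ (N.backwardBinop op a b z).1 ∧ y ∈ gammaBot γ (N.backwardBinop op a b z).2

theorem Itv.numDom_sound (s : SignFlag) : (numDom s).Sound (conc s) where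
  toSound := adom_sound s
  meet_sound := by rw [gammaBot_conc]; exact mem_meet
  range_sound h _ := mem_convert h
  const_sound _ := mem_singleton_val
  forwardUnop_sound op _ _ := forwardUnop_sound op
  forwardBinop_sound op _ _ _ _ _ := forwardBinop_sound op
  backwardUnop_sound op _ _ _ := by rw [gammaBot_conc]; exact backwardUnop_sound op
  backwardBinop_sound op _ _ _ _ _ _ := by rw [gammaBot_conc]; exact backwardBinop_sound op

theorem Itv.mem_meetBot {s : SignFlag} {n : MInt} : ∀ {i j : BotLift Itv},
    n ∈ gamma s i → n ∈ gamma s j → n ∈ gamma s (meetBot i j)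
  | some _, some _, hi, hj => mem_meet hi hj
  | none, _, hi, _ => hi.elim
  | some _, none, _, hj => hj.elim

/-- The reduction operator keeps every integer described by both intervals. -/
theorem Itv.mem_exchange {n : MInt} : ∀ {i j : BotLift Itv},
    n ∈ gammaBot (conc .signed) i → n ∈ gammaBot (conc .unsigned) j →
      n ∈ gammaBot (fun p => conc .signed p.1 ∩ conc .unsigned p.2) (exchange i j)
  | none, _, hi, _ => hi.elim
  | some _, none, _, hj => hj.elim
  | some i, some j, hi, hj => by
    have h₁ := mem_meet hi (mem_convert (q := .signed) hj)
    have h₂ := mem_meet hj (mem_convert (q := .unsigned) hi)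
    rw [← gammaBot_conc] at h₁ h₂
    simp only [exchange]
    cases e₁ : meet i (convert .unsigned .signed j) with
    | none => rw [e₁] at h₁; exact h₁.elim
    | some i' =>
      cases e₂ : meet j (convert .signed .unsigned i) with
      | none => rw [e₂] at h₂; exact h₂.elim
      | some j' =>
        rw [e₁] at h₁
        rw [e₂] at h₂
        exact ⟨h₁, h₂⟩

theorem NumDom.Sound.reducedProduct {t t' : Type} {N : NumDom t} {N' : NumDom t'}
    {γ : t → Set MInt} {γ' : t' → Set MInt} (h : N.Sound γ) (h' : N'.Sound γ')
    {ρ : BotLift t → BotLift t' → BotLift (t × t')}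
    (hρ : ∀ {n a b}, n ∈ gammaBot γ a → n ∈ gammaBot γ' b →
      n ∈ gammaBot (fun p => γ p.1 ∩ γ' p.2) (ρ a b)) :
    (N.reducedProduct N' ρ).Sound fun p => γ p.1 ∩ γ' p.2 where
  toSound := h.toSound.prod h'.toSound
  meet_sound ha hb := hρ (h.meet_sound ha.1 hb.1) (h'.meet_sound ha.2 hb.2)
  range_sound ha s := Itv.mem_meetBot (h.range_sound ha.1 s) (h'.range_sound ha.2 s)
  const_sound n := ⟨h.const_sound n, h'.const_sound n⟩
  forwardUnop_sound op _ _ ha :=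
    hρ (h.forwardUnop_sound op ha.1) (h'.forwardUnop_sound op ha.2)
  forwardBinop_sound op _ _ _ _ _ ha hb hr :=
    hρ (h.forwardBinop_sound op ha.1 hb.1 hr) (h'.forwardBinop_sound op ha.2 hb.2 hr)
  backwardUnop_sound op _ _ _ ha hz :=
    hρ (h.backwardUnop_sound op ha.1 hz.1) (h'.backwardUnop_sound op ha.2 hz.2)
  backwardBinop_sound op _ _ _ _ _ _ ha hb hr hz := by
    have k := h.backwardBinop_sound op ha.1 hb.1 hr hz.1
    have k' := h'.backwardBinop_sound op ha.2 hb.2 hr hz.2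
    exact ⟨hρ k.1 k'.1, hρ k.2 k'.2⟩

theorem rangeDom_sound :
    rangeDom.Sound fun p => Itv.conc .signed p.1 ∩ Itv.conc .unsigned p.2 :=
  (Itv.numDom_sound _).reducedProduct (Itv.numDom_sound _) Itv.mem_exchange

/-! ### Numerical expressions and non-relational environments -/

/-- Value of a numerical expression in an environment that gives an integer to every variable;
there is none when the execution gets stuck. -/
def NExpr.eval (ρ : Ident → MInt) : NExpr → Option MInt
  | .var x => some (ρ x)
  | .const n => some n
  | .unop op e => (e.eval ρ).map op.num
  | .binop op e₁ e₂ => (e₁.eval ρ).bind fun x => (e₂.eval ρ).bind fun y => op.num x y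
  | .cond b l r => (b.eval ρ).bind fun n => if n = 0 then r.eval ρ else l.eval ρ

/-- The laws of an abstraction of numerical environments with concretization `γ`. -/
structure IntDom.Sound {t : Type} (D : IntDom t) (γ : t → Set (Ident → MInt)) : Prop
    extends D.toADom.Sound γ where
  range_sound : ∀ {ab ρ e n}, ρ ∈ γ ab → e.eval ρ = some n →
    ∀ s, n ∈ Itv.gamma s (D.range e ab s)
  forget_sound : ∀ {ab ρ}, ρ ∈ γ ab → ∀ x n, Function.update ρ x n ∈ γ (D.forget x ab)
  assign_sound : ∀ {ab ρ e n}, ρ ∈ γ ab → e.eval ρ = some n → ∀ x,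
    Function.update ρ x n ∈ γ (D.assign x e ab)
  assume_sound : ∀ {ab ρ e}, ρ ∈ γ ab → e.eval ρ = some 1 → ρ ∈ γ (D.assume e ab)

namespace NonRel
variable {t : Type} {N : NumDom t} {γ : t → Set MInt}

/-- Concretization of non-relational environments. -/
abbrev conc (N : NumDom t) (γ : t → Set MInt) : AEnv t → Set (Ident → MInt) :=
  gammaBot (gammaTree N.toADom γ)

variable {ab : AEnv t} {ρ : Ident → MInt}

theorem get_sound (h : ρ ∈ conc N γ ab) (x : Ident) : ρ x ∈ gammaBot γ (get N ab x) := by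
  cases ab with
  | none => exact h.elim
  | some m => exact h x

theorem set_sound (h : ρ ∈ conc N γ ab) (x : Ident) {a : BotLift t} {n : MInt}
    (hn : n ∈ gammaBot γ a) : Function.update ρ x n ∈ conc N γ (set ab x a) := by
  cases ab with
  | none => exact h.elim
  | some m =>
    cases a with
    | none => exact hn.elim
    | some a => exact mem_gammaTree_set h x hn

theorem eval_sound (hN : N.Sound γ) (h : ρ ∈ conc N γ ab) {e : NExpr} {n : MInt}
    (he : e.eval ρ = some n) : n ∈ gammaBot γ (eval N e ab) := by
  induction e generalizing n with
  | var x =>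
    obtain rfl : ρ x = n := by simpa [NExpr.eval] using he
    exact get_sound h x
  | const k =>
    obtain rfl : k = n := by simpa [NExpr.eval] using he
    cases ab with
    | none => exact h.elim
    | some m => exact hN.const_sound k
  | unop op e ih =>
    obtain ⟨k, hk, rfl⟩ := Option.map_eq_some_iff.1 he
    exact mem_gammaBot_bind (ih hk) fun a ha => hN.forwardUnop_sound op ha
  | binop op e₁ e₂ ih₁ ih₂ =>
    obtain ⟨x, hx, he⟩ := Option.bind_eq_some_iff.1 he
    obtain ⟨y, hy, he⟩ := Option.bind_eq_some_iff.1 he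
    exact mem_gammaBot_bind (ih₁ hx) fun a ha => mem_gammaBot_bind (ih₂ hy) fun b hb =>
      hN.forwardBinop_sound op ha hb he
  | cond b l r ihb ihl ihr =>
    -- The guard of the branch that is taken, which tests its condition, is not bottom.
    obtain ⟨k, hk, he⟩ := Option.bind_eq_some_iff.1 he
    refine mem_gammaBot_bind (ihb hk) fun a ha => hN.toSound.liftBot.join_sound _ _ ?_
    split at he
    next h0 =>
      exact .inr (mem_gammaBot_bind (hN.meet_sound ha (h0 ▸ hN.const_sound 0)) fun _ _ => ihr he)
    next h0 =>
      refine .inl (mem_gammaBot_bind (hN.backwardUnop_sound .boolval ha ?_) fun _ _ => ihl he)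
      rw [UnOp.num, if_neg h0]
      exact hN.const_sound 1

/-- Backward evaluation only removes environments in which the expression has no value in `z`. -/
theorem backwardExpr_sound (hN : N.Sound γ) (h : ρ ∈ conc N γ ab) {e : NExpr} {n : MInt}
    (he : e.eval ρ = some n) {z : t} (hz : n ∈ γ z) : ρ ∈ conc N γ (backwardExpr N e ab z) := by
  induction e generalizing ab n z with
  | var x =>
    obtain rfl : ρ x = n := by simpa [NExpr.eval] using he
    have := set_sound h x (mem_gammaBot_bind (get_sound h x) fun a ha => hN.meet_sound ha hz)
    rwa [Function.update_eq_self] at this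
  | const k =>
    obtain rfl : k = n := by simpa [NExpr.eval] using he
    exact mem_gammaBot_bind (hN.meet_sound (hN.const_sound k) hz) fun _ _ => h
  | unop op e ih =>
    obtain ⟨k, hk, rfl⟩ := Option.map_eq_some_iff.1 he
    exact mem_gammaBot_bind
      (mem_gammaBot_bind (eval_sound hN h hk) fun a ha => hN.backwardUnop_sound op ha hz)
      fun a ha => ih h hk ha
  | binop op e₁ e₂ ih₁ ih₂ =>
    obtain ⟨x, hx, he⟩ := Option.bind_eq_some_iff.1 he
    obtain ⟨y, hy, he⟩ := Option.bind_eq_some_iff.1 he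
    refine mem_gammaBot_bind (eval_sound hN h hx) fun a ha =>
      mem_gammaBot_bind (eval_sound hN h hy) fun b hb => ?_
    obtain ⟨k₁, k₂⟩ := hN.backwardBinop_sound op ha hb he hz
    exact mem_gammaBot_bind k₁ fun a' ha' => mem_gammaBot_bind k₂ fun b' hb' =>
      ih₁ (ih₂ h hy hb') hx ha'
  | cond b l r ihb ihl ihr =>
    obtain ⟨k, hk, he⟩ := Option.bind_eq_some_iff.1 he
    refine hN.toSound.tree.liftBot.join_sound _ _ ?_
    split at he
    next h0 => exact .inl (ihb (ihr h he hz) (h0 ▸ hk) (hN.const_sound 0))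
    next h0 =>
      refine .inr (mem_gammaBot_bind (mem_gammaBot_bind (eval_sound hN h hk) fun a ha =>
        hN.backwardUnop_sound .boolval ha ?_) fun a' ha' => ihb (ihl h he hz) hk ha')
      rw [UnOp.num, if_neg h0]
      exact hN.const_sound 1

theorem make_sound (hN : N.Sound γ) : (make N).Sound (conc N γ) where
  toSound := hN.toSound.tree.liftBot
  range_sound {_ _ _ n} h he s := by
    have hb {i : BotLift Itv} : n ∈ gammaBot (Itv.conc s) i ↔ n ∈ Itv.gamma s i := by
      rw [Itv.gammaBot_conc]
    exact hb.1 (mem_gammaBot_bind (eval_sound hN h he) fun a ha => hb.2 (hN.range_sound ha s))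
  forget_sound {ab _} h x n := by
    cases ab with
    | none => exact h.elim
    | some m => exact mem_gammaTree_remove hN.toSound h x n
  assign_sound h he x := set_sound h x (eval_sound hN h he)
  assume_sound h he := backwardExpr_sound hN h he (hN.const_sound 1)

end NonRel

/-! ### Type information and translation of expressions -/

/-- `n` represents the value: an integer is represented by itself only, a pointer by its offset
only, and the other values by every integer, so that every value has a representation. -/
def Val.RepBy : Val → MInt → Prop
  | .vint i, n | .vptr _ i, n => i = n
  | _, _ => True

/-- Membership of a value in a type. Floats and `undef` have every type. -/
def Ty.Has : Ty → Val → Prop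
  | .int, .vptr _ _ => False
  | .ptr, .vint _ => False
  | _, _ => True

theorem Ty.has_any (v : Val) : Ty.any.Has v := by cases v <;> trivial

theorem Ty.Has.join {a b : Ty} {v : Val} (h : a.Has v ∨ b.Has v) : (a.join b).Has v := by
  unfold Ty.join
  split
  next hab => subst hab; exact h.elim id id
  next => exact Ty.has_any v

/-- Concretization of types. Unbound variables have every type. -/
def Ty.conc (a : Ty) : Set (Option Val) := {o | ∀ v, o = some v → a.Has v}

theorem Ty.adom_sound : Ty.adom.Sound Ty.conc where
  gamma_monotone a b h o ho v hv := by
    simp only [adom, decide_eq_true_eq] at h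
    rcases h with rfl | rfl
    · exact has_any v
    · exact ho v hv
  top_sound o v _ := has_any v
  join_sound a b := by
    rintro o (ho | ho) v hv
    · exact .join (.inl (ho v hv))
    · exact .join (.inr (ho v hv))

/-- Truth values tell integers and pointers apart, hence the side condition. -/
theorem evalUnop_repBy {op : UnOp} {v : Val} {n : MInt} (h : v.RepBy n)
    (ht : op = .boolval ∨ op = .notbool → Ty.int.Has v) : (evalUnop op v).RepBy (op.num n) := by
  cases v with
  | vint i =>
    obtain rfl : i = n := h
    by_cases hi : i = 0#32 <;> cases op <;>
      simp [evalUnop, UnOp.num, boolOfVal, ofOptBool, ofBool, vtrue, vfalse, Val.RepBy, hi]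
  | vptr b i =>
    cases op <;> first | trivial | exact (ht (by simp)).elim
  | _ => cases op <;> trivial

theorem evalUnop_int (op : UnOp) (v : Val) : Ty.int.Has (evalUnop op v) := by
  have hb (b : Bool) : Ty.int.Has (ofBool b) := by cases b <;> trivial
  cases v <;> cases op <;> first | trivial | exact hb _

theorem ofOptBool_int (o : Option Bool) : Ty.int.Has (ofOptBool o) := by
  rcases o with _ | _ | _ <;> trivial

theorem ofOptBool_repBy {o : Option Bool} {b : Bool} (h : ∀ b', o = some b' → b' = b) :
    (ofOptBool o).RepBy (bit b) := by
  cases o with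
  | none => trivial
  | some b' =>
    obtain rfl := h b' rfl
    cases b' <;> rfl

/-- A result that is an integer or a pointer is determined by the numerical views of the operands,
except for unsigned comparisons that involve pointers; hence the side condition. -/
theorem evalBinop_repBy {m : Mem} {op : BinOp} {v₁ v₂ v : Val} {n₁ n₂ : MInt}
    (hv : evalBinop m op v₁ v₂ = some v) (h₁ : v₁.RepBy n₁) (h₂ : v₂.RepBy n₂)
    (ht : ∀ c, op = .cmpu c → Ty.int.Has v₁ ∧ Ty.int.Has v₂) :
    ∃ n, op.num n₁ n₂ = some n ∧ v.RepBy n := by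
  cases op with
  | cmp c =>
    obtain rfl := Option.some.inj hv
    refine ⟨_, rfl, ofOptBool_repBy fun b hb => ?_⟩
    cases v₁ <;> cases v₂ <;> simp only [cmpBool, Option.some.injEq, reduceCtorEq] at hb
    rw [← hb, show _ = n₁ from h₁, show _ = n₂ from h₂]
  | cmpu c =>
    obtain rfl := Option.some.inj hv
    obtain ⟨t₁, t₂⟩ := ht c rfl
    refine ⟨_, rfl, ofOptBool_repBy fun b hb => ?_⟩
    cases v₁ <;> cases v₂ <;>
      first
        | exact t₁.elim
        | exact t₂.elim
        | simp only [cmpuBool, Option.some.injEq, reduceCtorEq] at hb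
    rw [← hb, show _ = n₁ from h₁, show _ = n₂ from h₂]
  | _ =>
    cases v₁ <;> cases v₂ <;>
      simp only [evalBinop, Option.some.injEq, Option.ite_none_left_eq_some, reduceCtorEq,
        Val.RepBy] at hv h₁ h₂ <;>
      subst_vars <;>
      first
        | exact ⟨_, rfl, rfl⟩
        | exact ⟨_, rfl, trivial⟩
        | exact ⟨_, rfl, BitVec.add_comm _ _⟩
        | exact hv.2 ▸ ⟨_, if_neg hv.1, rfl⟩
        | exact ⟨_, rfl, by split <;> trivial⟩

theorem ite_undef_int (c : Prop) [Decidable c] (n : MInt) :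
    Ty.int.Has (if c then .vint n else .undef) := by
  split <;> trivial

theorem evalBinop_int {m : Mem} {op : BinOp} {v₁ v₂ v : Val}
    (hv : evalBinop m op v₁ v₂ = some v) (h₁ : op ≠ .add) (h₂ : op ≠ .sub) : Ty.int.Has v := by
  cases op with
  | add => exact absurd rfl h₁
  | sub => exact absurd rfl h₂
  | cmp c => exact Option.some.inj hv ▸ ofOptBool_int _
  | cmpu c => exact Option.some.inj hv ▸ ofOptBool_int _
  | _ =>
    cases v₁ <;> cases v₂ <;>
      simp only [evalBinop, Option.some.injEq, Option.ite_none_left_eq_some, reduceCtorEq] at hv <;>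
      first | exact hv ▸ trivial | exact hv.2 ▸ trivial | exact hv ▸ ite_undef_int _ _

theorem decodeVal_int {be : Bool} {κ : Chunk} {vl : List Memval} (hκ : κ ≠ .int32) :
    Ty.int.Has (decodeVal be κ vl) := by
  unfold decodeVal
  cases κ <;> first | exact absurd rfl hκ | (split <;> trivial)

namespace AbMem

theorem typeOf_sound {C : Ctx} {sp : Block} {E : Env} {m : Mem} {tp : TypeInfo}
    (hE : E ∈ gammaTree Ty.adom Ty.conc tp) {a : Expr} {v : Val} (h : EvalExpr C sp E m a v) :
    (typeOf tp a).Has v := by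
  induction h with
  | @var x v hx => exact hE x v hx
  | @const c =>
    cases c <;> simp only [typeOf, evalConst] <;> first | trivial | (split <;> trivial)
  | unop _ _ => rw [typeOf]; exact evalUnop_int _ _
  | @binop op a₁ a₂ v₁ v₂ v _ _ hv ih₁ ih₂ =>
    by_cases hadd : op = .add
    · subst hadd
      rw [typeOf]
      generalize typeOf tp a₁ = t₁ at ih₁ ⊢
      generalize typeOf tp a₂ = t₂ at ih₂ ⊢
      cases v₁ <;> cases v₂ <;> cases Option.some.inj hv <;> cases t₁ <;> cases t₂ <;>
        trivial
    by_cases hsub : op = .sub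
    · subst hsub
      rw [typeOf]
      generalize typeOf tp a₁ = t₁ at ih₁ ⊢
      generalize typeOf tp a₂ = t₂ at ih₂ ⊢
      cases v₁ <;> cases v₂ <;> cases Option.some.inj hv <;> cases t₁ <;> cases t₂ <;>
        first | trivial | exact ih₁.elim | exact ih₂.elim | exact ite_undef_int _ _
    rw [typeOf]
    · exact evalBinop_int hv hadd hsub
    · exact hadd
    · exact hsub
  | @cond a₁ a₂ a₃ v₁ b v _ _ _ _ ih =>
    rw [typeOf]
    cases b
    · exact .join (.inr ih)
    · exact .join (.inl ih)
  | @load κ a va v _ hv _ =>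
    cases va <;> simp only [Mem.loadv, reduceCtorEq] at hv
    unfold Mem.load at hv
    split at hv
    · obtain rfl := Option.some.inj hv
      cases κ <;> first | exact Ty.has_any _ | exact decodeVal_int (by simp)
    · simp at hv

/-- The translation of an expression is defined whenever the expression is, even on `undef`. This
is why the abstract value of the translation cannot be bottom. -/
theorem convert_sound {C : Ctx} {sp : Block} {E : Env} {m : Mem} {tp : TypeInfo}
    (hE : E ∈ gammaTree Ty.adom Ty.conc tp) {ρ : Ident → MInt}
    (hρ : ∀ x v, E x = some v → v.RepBy (ρ x)) {a : Expr} {v : Val} (h : EvalExpr C sp E m a v)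
    {e : NExpr} (he : convert tp a = some e) : ∃ n, e.eval ρ = some n ∧ v.RepBy n := by
  induction h generalizing e with
  | @var x v hx =>
    obtain rfl : .var x = e := by simpa [convert] using he
    exact ⟨ρ x, rfl, hρ x v hx⟩
  | @const c =>
    cases c <;> simp only [convert, Option.some.injEq, reduceCtorEq] at he <;> subst he <;>
      refine ⟨_, rfl, ?_⟩ <;> simp only [evalConst]
    · rfl
    · split <;> trivial
    · rfl
  | @unop op a v h ih =>
    rw [convert] at he
    split at he
    · simp at he
    next ht =>
      obtain ⟨e', he', rfl⟩ := Option.map_eq_some_iff.1 he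
      obtain ⟨n, hn, hv⟩ := ih he'
      refine ⟨op.num n, by simp [NExpr.eval, hn], evalUnop_repBy hv fun hop => ?_⟩
      have := typeOf_sound hE h
      rwa [not_not.1 fun hne => ht ⟨hop, hne⟩] at this
  | @binop op a₁ a₂ v₁ v₂ v h₁ h₂ hv ih₁ ih₂ =>
    have key : ∃ e₁ e₂, convert tp a₁ = some e₁ ∧ convert tp a₂ = some e₂ ∧ e = .binop op e₁ e₂ ∧
        ∀ c, op = .cmpu c → typeOf tp a₁ = .int ∧ typeOf tp a₂ = .int := by
      rw [convert.eq_def] at he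
      cases op
      case cmpu c =>
        simp only [Option.ite_none_right_eq_some] at he
        obtain ⟨ht, he⟩ := he
        obtain ⟨e₁, he₁, he⟩ := Option.bind_eq_some_iff.1 he
        obtain ⟨e₂, he₂, rfl⟩ := Option.map_eq_some_iff.1 he
        exact ⟨e₁, e₂, he₁, he₂, rfl, fun _ _ => ht⟩
      all_goals
        obtain ⟨e₁, he₁, he⟩ := Option.bind_eq_some_iff.1 he
        obtain ⟨e₂, he₂, rfl⟩ := Option.map_eq_some_iff.1 he
        exact ⟨e₁, e₂, he₁, he₂, rfl, fun _ hc => by simp at hc⟩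
    obtain ⟨e₁, e₂, he₁, he₂, rfl, ht⟩ := key
    obtain ⟨n₁, hn₁, hr₁⟩ := ih₁ he₁
    obtain ⟨n₂, hn₂, hr₂⟩ := ih₂ he₂
    have t₁ := typeOf_sound hE h₁
    have t₂ := typeOf_sound hE h₂
    obtain ⟨n, hn, hr⟩ := evalBinop_repBy hv hr₁ hr₂ fun c hc =>
      ⟨(ht c hc).1 ▸ t₁, (ht c hc).2 ▸ t₂⟩
    exact ⟨n, by simp [NExpr.eval, hn₁, hn₂, hn], hr⟩
  | @cond a₁ a₂ a₃ v₁ b v h₁ hb _ ih₁ ih =>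
    rw [convert] at he
    split at he
    next ht =>
      obtain ⟨e₁, he₁, he⟩ := Option.bind_eq_some_iff.1 he
      obtain ⟨e₂, he₂, he⟩ := Option.bind_eq_some_iff.1 he
      obtain ⟨e₃, he₃, rfl⟩ := Option.map_eq_some_iff.1 he
      obtain ⟨n₁, hn₁, hr₁⟩ := ih₁ he₁
      have t₁ := typeOf_sound hE h₁
      rw [ht] at t₁
      cases v₁ with
      | vint i =>
        obtain rfl : i = n₁ := hr₁
        obtain rfl : (i != 0) = b := by simpa [boolOfVal] using hb
        by_cases hi : i = 0
        · obtain ⟨n, hn, hr⟩ := ih (e := e₃) (by rwa [if_neg (by simpa using hi)])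
          exact ⟨n, by rw [NExpr.eval, hn₁, Option.bind_some, if_pos hi, hn], hr⟩
        · obtain ⟨n, hn, hr⟩ := ih (e := e₂) (by rwa [if_pos (by simpa using hi)])
          exact ⟨n, by rw [NExpr.eval, hn₁, Option.bind_some, if_neg hi, hn], hr⟩
      | vptr => exact t₁.elim
      | _ => simp [boolOfVal] at hb
    next => simp at he
  | load => simp [convert] at he

/-! ### The memory domain of the analyzer -/

/-- The numerical environment `ρ` gives to each variable that holds an integer or a pointer its
numerical view, and anything to the others. -/
def EnvRep (s : Env × Mem) (ρ : Ident → MInt) : Prop := ∀ x v, s.1 x = some v → v.RepBy (ρ x)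

theorem exists_envRep (s : Env × Mem) : ∃ ρ, EnvRep s ρ := by
  refine ⟨fun x => match s.1 x with
    | some (.vint i) | some (.vptr _ i) => i
    | _ => 0, fun x v hv => ?_⟩
  simp only [hv]
  cases v <;> trivial

theorem EnvRep.set {E : Env} {m m' : Mem} {ρ : Ident → MInt} (h : EnvRep (E, m) ρ) (x : Ident)
    {v : Val} {n : MInt} (hv : v.RepBy n) : EnvRep (E.set x v, m') (Function.update ρ x n) := by
  intro y w hw
  by_cases hy : y = x
  · subst hy
    obtain rfl : v = w := by simpa [Env.set] using hw
    simpa using hv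
  · simp only [Env.set, Function.update_of_ne hy] at hw ⊢
    exact h y w hw

/-- Concretization of the memory domain: the environments that respect the type information and
are represented by some numerical environment. The memory is not constrained. -/
def conc {t : Type} (γ : t → Set (Ident → MInt)) (ab : t × TypeInfo) : Set (Env × Mem) :=
  {s | ∃ ρ ∈ γ ab.1, EnvRep s ρ} ∩
    {s | ∃ E ∈ gammaTree Ty.adom Ty.conc ab.2, s.1 = E}

variable {t : Type} {num : IntDom t} {γ : t → Set (Ident → MInt)}

theorem mem_conc {ab : t × TypeInfo} {E : Env} {m : Mem} : (E, m) ∈ conc γ ab ↔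
    (∃ ρ ∈ γ ab.1, EnvRep (E, m) ρ) ∧ E ∈ gammaTree Ty.adom Ty.conc ab.2 := by
  simp [conc]

/-- Forgetting a variable accounts for any new value of it, and for any change of the memory. -/
theorem forget_sound (hnum : num.Sound γ) {ab : t × TypeInfo} {E : Env} {m : Mem}
    (h : (E, m) ∈ conc γ ab) (x : Ident) (v : Val) (m' : Mem) :
    (E.set x v, m') ∈ conc γ (forget num x ab) := by
  obtain ⟨⟨ρ, hρ, hr⟩, hE⟩ := mem_conc.1 h
  obtain ⟨n, hn⟩ : ∃ n, v.RepBy n := by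
    cases v <;> first | exact ⟨_, rfl⟩ | exact ⟨0, trivial⟩
  exact mem_conc.2 ⟨⟨_, hnum.forget_sound hρ x n, hr.set x hn⟩,
    mem_gammaTree_remove Ty.adom_sound hE x (some v)⟩

theorem make_sound (C : Ctx) (hnum : num.Sound γ) : (make num).Sound C (conc γ) where
  toSound := (hnum.toSound.preimage EnvRep exists_envRep).prod
    (Ty.adom_sound.tree.preimage _ fun s => ⟨s.1, rfl⟩)
  range_sound ab E m x i h hx := by
    obtain ⟨⟨ρ, hρ, hr⟩, -⟩ := mem_conc.1 h
    obtain rfl : i = ρ x := by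
      rcases hx with hx | ⟨b, hx⟩
      · exact hr x _ hx
      · exact hr x _ hx
    exact ⟨hnum.range_sound hρ rfl _, hnum.range_sound hρ rfl _⟩
  forget_sound x ab := by
    rintro ⟨_, m'⟩ ⟨E, m, v, h, rfl⟩
    cases x with
    | none => exact mem_conc.2 (mem_conc.1 h)
    | some x => exact forget_sound hnum h x v m'
  assign_sound x a ab := by
    rintro ⟨_, m⟩ ⟨sp, E, v, h, hv, rfl⟩
    simp only [make, assign]
    split
    next => exact forget_sound hnum h x v m
    next e he =>
      obtain ⟨⟨ρ, hρ, hr⟩, hE⟩ := mem_conc.1 h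
      obtain ⟨n, hn, hrv⟩ := convert_sound hE hr hv he
      refine mem_conc.2 ⟨⟨_, hnum.assign_sound hρ hn x, hr.set x hrv⟩, ?_⟩
      refine mem_gammaTree_set hE x fun w hw => ?_
      obtain rfl := Option.some.inj hw
      exact typeOf_sound hE hv
  store_sound κ a₁ a₂ ab := by
    rintro ⟨E, m'⟩ ⟨sp, m, v₁, v₂, h, -⟩
    exact mem_conc.2 (mem_conc.1 h)
  assume_sound a ab := by
    rintro ⟨E, m⟩ ⟨h, sp, v, hv, hb⟩
    simp only [make, assume]
    split
    next => exact h
    next e he =>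
      obtain ⟨⟨ρ, hρ, hr⟩, hE⟩ := mem_conc.1 h
      obtain ⟨n, hn, hrv⟩ := convert_sound hE hr (.unop (op := .boolval) hv) he
      obtain rfl : (1 : MInt) = n := by
        simp only [evalUnop, hb] at hrv
        exact hrv
      exact mem_conc.2 ⟨⟨ρ, hnum.assume_sound hρ hn, hr⟩, hE⟩

end AbMem

theorem exists_memDom_sound (C : Ctx) : ∃ γ, memDom.Sound C γ :=
  ⟨_, AbMem.make_sound C (NonRel.make_sound rangeDom_sound)⟩

end CFG

/-- Soundness of the value analysis: over the domain of the analyzer (signed and unsigned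
intervals), and over any other memory domain that obeys the laws of its interface. -/
theorem mainTheorem1 (C : CFG.Ctx) :
    (∀ externFixpoint, ∀ σ ∈ CFG.Reach C, ∀ l, σ.point = some l →
      ∀ v i, σ.env.Holds v i →
        CFG.IntsInRange (CFG.valueAnalysis CFG.memDom externFixpoint C.prog l v) i) ∧
    (∀ (t : Type) (D : CFG.MemDom t) (γ : t → Set (CFG.Env × CFG.Mem)), D.Sound C γ →
      ∀ externFixpoint, ∀ σ ∈ CFG.Reach C, ∀ l, σ.point = some l →
        ∀ v i, σ.env.Holds v i →
          CFG.IntsInRange (CFG.valueAnalysis D externFixpoint C.prog l v) i) := by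
  obtain ⟨γ, hγ⟩ := CFG.exists_memDom_sound C
  exact ⟨fun ext σ hσ l hl v i hv => CFG.valueAnalysis_sound hγ ext hσ hl hv,
    fun t D γ hD ext σ hσ l hl v i hv => CFG.valueAnalysis_sound hD ext hσ hl hv⟩
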